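/- **Setting.** Write $[N]=\{0,\dots,N-1\}$. Let $\mathcal E$ be a quantum operation (completely positive, trace-preserving map) on $N\times N$ complex matrices that is *invariantly $d$-sparse* with transition sets $S_x\subseteq[N]$: for all $x,y$, $\mathcal E(|x\rangle\langle y|)\in\operatorname{span}\{|x'\rangle\langle y'| : x'\in S_x,\ y'\in S_y\}$; $|S_x|\le d$; and for $x\ne y$ either $S_x\cap S_y=\emptyset$ or $S_x=S_y$. Let $V:\mathbb C^N\to\mathbb C^N\otimes(\mathbb C^2)^{\otimes m}$ be an invariantly $d$-sparse Stinespring isometry of $\mathcal E$: $V^\dagger V=I$, $\mathcal E(\rho)=\operatorname{Tr}_{\mathrm{anc}}[V\rho V^\dagger]$ for all $\rho$, and $$V|x\rangle=\sum_{i=0}^{r_x-1}|\nu^i(x)\rangle|\phi_{x,i}\rangle\qquad(x\in[N])$$ for some (not necessarily normalized) $m$-qubit states $|\phi_{x,i}\rangle$, where $\nu$ is a permutation of $[N]$, $r_x\le d$ is the length of the cycle of $x$ under $\nu$, and $S_x=\{x,\nu(x),\dots,\nu^{r_x-1}(x)\}$. **Algorithms.** A two-qubit gate is an arbitrary unitary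 on at most two qubits. An algorithm has a system register of $\lceil\log_2 N\rceil$ qubits holding $|x\rangle$ in binary, any number of work qubits, initially $|0\cdots0\rangle$, and an answer register whose basis states $|A\rangle$ are the subsets $A\subseteq[N]$, initially $|\emptyset\rangle$. It is a finite sequence of steps, each of which is either one query to the black box, $|x\rangle|A\rangle\mapsto|x\rangle|A\,\triangle\,S_x\rangle$, or one two-qubit gate on the system and work qubits. The gate to be applied in a given step is read off a classical description computed from the content of the answer register, so that the step acts as $\sum_A g(A)\otimes|A\rangle\langle A|$ with a two-qubit gate $g(A)$ for each $A$; computing the classical description is not counted. The algorithm implements $\mathcal E$ if, for every $\rho$, running it on input $\rho$ in the system register and tracing out everything else leaves exactly $\mathcal E(\rho)$ in the system register. **Theorem.** For every $K$ there is a constant $C$ such that the following holds for all $N,d,m,c_\phi$ and all $\mathcal E,S,V,\nu,\phi$ as above. Suppose that for all $x\in[N]$ and $0\le i<r_x$ with $|\phi_{x,i}\rangle\ne0$ the state $|\phi_{x,i}\rangle/\||\phi_{x,i}\rangle\|$ can be prepared from $|0\rangle^{\otimes m}$ by a circuit of at most $K c_\phi$ two-qubit gates. Then $\mathcal E$ can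 be implemented by an algorithm that uses at most $C\,d^2(\log N+c_\phi)$ two-qubit gates and at most $C$ queries to the black box. -/

import Mathlib

namespace SparseStinespring

noncomputable section

open scoped ComplexOrder

/-! ## Two-qubit gates and circuits -/

/-- A gate acting on at most two of the qubits labelled by `ι`: an arbitrary unitary on one qubit
or on two distinct qubits. -/
inductive Gate (ι : Type) : Type
  | one (a : ι) (u : Matrix.unitaryGroup Bool ℂ) : Gate ι
  | two (a b : ι) (hab : a ≠ b) (u : Matrix.unitaryGroup (Bool × Bool) ℂ) : Gate ι

/-- The operator of a gate on the whole register, in the computational basis `ι → Bool`: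
the gate's unitary on its qubits, tensored with the identity on all other qubits. -/
def Gate.toMatrix {ι : Type} [Fintype ι] [DecidableEq ι] :
    Gate ι → Matrix (ι → Bool) (ι → Bool) ℂ
  | .one a u => Matrix.of fun s t =>
      if ∀ q, q ≠ a → s q = t q then (u : Matrix Bool Bool ℂ) (s a) (t a) else 0
  | .two a b _ u => Matrix.of fun s t =>
      if ∀ q, q ≠ a → q ≠ b → s q = t q then
        (u : Matrix (Bool × Bool) (Bool × Bool) ℂ) (s a, s b) (t a, t b) else 0

/-- The operator of a circuit; the head of the list is applied first. -/
def circuitMatrix {ι : Type} [Fintype ι] [DecidableEq ι] :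
    List (Gate ι) → Matrix (ι → Bool) (ι → Bool) ℂ
  | [] => 1
  | g :: gs => circuitMatrix gs * g.toMatrix

/-- The `m`-qubit state `ψ` can be prepared from `|0…0⟩` by at most `c` two-qubit gates. -/
def Preparable {m : ℕ} (ψ : EuclideanSpace ℂ (Fin m → Bool)) (c : ℕ) : Prop :=
  ∃ gs : List (Gate (Fin m)), gs.length ≤ c ∧
    (circuitMatrix gs).mulVec (Pi.single (fun _ => false) 1) = WithLp.ofLp ψ

/-! ## Quantum operations and sparse Stinespring isometries -/

/-- A linear map on `N × N` matrices. -/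
abbrev SuperOp (N : ℕ) : Type :=
  Matrix (Fin N) (Fin N) ℂ →ₗ[ℂ] Matrix (Fin N) (Fin N) ℂ

/-- The map `E ⊗ id` on `N × N` matrices tensored with `k × k` matrices. -/
def ampliation {N : ℕ} (E : SuperOp N) (k : ℕ)
    (M : Matrix (Fin N × Fin k) (Fin N × Fin k) ℂ) :
    Matrix (Fin N × Fin k) (Fin N × Fin k) ℂ :=
  Matrix.of fun p q => E (Matrix.of fun a b => M (a, p.2) (b, q.2)) p.1 q.1

/-- A quantum operation: a completely positive trace-preserving map. -/
structure IsQuantumOperation {N : ℕ} (E : SuperOp N) : Prop where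
  completelyPositive : ∀ (k : ℕ) (M : Matrix (Fin N × Fin k) (Fin N × Fin k) ℂ),
    M.PosSemidef → (ampliation E k M).PosSemidef
  tracePreserving : ∀ ρ, (E ρ).trace = ρ.trace

/-- `E` is invariantly `d`-sparse with transition sets `S x`:
`E(|x⟩⟨y|)` lies in the span of the `|x'⟩⟨y'|` with `x' ∈ S x`, `y' ∈ S y`, each `S x` has at most
`d` elements, and any two of the sets are disjoint or equal. -/
structure IsInvariantlySparse {N : ℕ} (d : ℕ) (E : SuperOp N)
    (S : Fin N → Finset (Fin N)) : Prop where
  card_le : ∀ x, (S x).card ≤ d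
  disjoint_or_eq : ∀ x y, x ≠ y → Disjoint (S x) (S y) ∨ S x = S y
  support : ∀ x y x' y', E (Matrix.single x y 1) x' y' ≠ 0 → x' ∈ S x ∧ y' ∈ S y

/-- The length `r_x` of the cycle of `x` under the permutation `ν`. -/
def cycleLength {N : ℕ} (ν : Equiv.Perm (Fin N)) (x : Fin N) : ℕ :=
  Function.minimalPeriod ν x

/-- `V` is an invariantly `d`-sparse isometry from `ℂ^N` to `ℂ^N ⊗ (ℂ²)^{⊗m}` with neighbour
permutation `ν`, all of whose cycles have length at most `d`, and (unnormalized) ancilla states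
`φ x i`: `V|x⟩ = ∑_{i < r_x} |ν^i(x)⟩|φ x i⟩`. Only the `φ x i` with `i < r_x` matter. -/
structure IsSparseIsometry {N m : ℕ} (d : ℕ)
    (V : Matrix (Fin N × (Fin m → Bool)) (Fin N) ℂ) (ν : Equiv.Perm (Fin N))
    (φ : Fin N → ℕ → EuclideanSpace ℂ (Fin m → Bool)) : Prop where
  isometry : V.conjTranspose * V = 1
  cycleLength_le : ∀ x, cycleLength ν x ≤ d
  apply_eq : ∀ x y a,
    V (y, a) x = ∑ i ∈ Finset.range (cycleLength ν x), if (ν ^ i) x = y then φ x i a else 0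

/-- The partial trace over the ancilla. -/
def traceAncilla {N m : ℕ}
    (M : Matrix (Fin N × (Fin m → Bool)) (Fin N × (Fin m → Bool)) ℂ) :
    Matrix (Fin N) (Fin N) ℂ :=
  Matrix.of fun x y => ∑ a, M (x, a) (y, a)

/-! ## Query algorithms -/

/-- Binary encoding of a system basis state `x` in `⌈log₂ N⌉` qubits. -/
def encode {N : ℕ} (x : Fin N) : Fin (Nat.clog 2 N) → Bool :=
  fun j => Nat.testBit x j

/-- Qubits of an algorithm: the system register and `w` work qubits. -/
abbrev Qubits (N w : ℕ) : Type := Fin (Nat.clog 2 N) ⊕ Fin w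

/-- Computational basis of an algorithm: the qubits together with an answer register, whose basis
states `|A⟩` are the subsets `A` of the set of system basis states. -/
abbrev Config (N w : ℕ) : Type := (Qubits N w → Bool) × Finset (Fin N)

/-- One step of an algorithm: a query to the black box, or one two-qubit gate on the system and
work qubits. Which gate is applied is read off a classical description computed from the content
of the answer register. A gate step never acts on the answer register, and the choice of gate
cannot depend on the system and work qubits. -/
inductive Step (N w : ℕ) : Type
  | query : Step N w
  | gate (g : Finset (Fin N) → Gate (Qubits N w)) : Step N w

/-- The set the black box returns for the content of the system register
(the empty set if that content encodes no `x`). -/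
def answer {N w : ℕ} (S : Fin N → Finset (Fin N)) (s : Qubits N w → Bool) : Finset (Fin N) :=
  open Classical in
  Finset.univ.filter fun y => ∃ x, encode x = (fun j => s (Sum.inl j)) ∧ y ∈ S x

/-- The operator of a step. The black box acts by `|x⟩|A⟩ ↦ |x⟩|A ∆ S x⟩`
(bitwise XOR of indicator vectors), so it is its own inverse; a gate step acts by
`∑_A g(A) ⊗ |A⟩⟨A|`. -/
def Step.toMatrix {N w : ℕ} (S : Fin N → Finset (Fin N)) :
    Step N w → Matrix (Config N w) (Config N w) ℂ
  | .query => Matrix.of fun p q =>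
      if p.1 = q.1 ∧ p.2 = symmDiff q.2 (answer S q.1) then 1 else 0
  | .gate g => Matrix.of fun p q =>
      if p.2 = q.2 then (g q.2).toMatrix p.1 q.1 else 0

/-- The operator of an algorithm; the head of the list is executed first. -/
def runMatrix {N w : ℕ} (S : Fin N → Finset (Fin N)) :
    List (Step N w) → Matrix (Config N w) (Config N w) ℂ
  | [] => 1
  | p :: ps => runMatrix S ps * p.toMatrix S

/-- Number of black-box queries. -/
def queryCount {N w : ℕ} : List (Step N w) → ℕ
  | [] => 0
  | .query :: ps => queryCount ps + 1
  | .gate _ :: ps => queryCount ps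

/-- Number of two-qubit gates. -/
def gateCount {N w : ℕ} : List (Step N w) → ℕ
  | [] => 0
  | .query :: ps => gateCount ps
  | .gate _ :: ps => gateCount ps + 1

/-- The isometry `|x⟩ ↦ |x⟩|0…0⟩|∅⟩` that prepares the input of an algorithm. -/
def inputIsometry (N w : ℕ) : Matrix (Config N w) (Fin N) ℂ :=
  Matrix.of fun p x => if p = (Sum.elim (encode x) (fun _ => false), ∅) then 1 else 0

/-- The isometry `|x⟩ ↦ |x⟩` that embeds `ℂ^N` into the system register. -/
def systemIsometry (N : ℕ) : Matrix (Fin (Nat.clog 2 N) → Bool) (Fin N) ℂ :=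
  Matrix.of fun s x => if s = encode x then 1 else 0

/-- The partial trace over everything but the system register. -/
def traceWork {N w : ℕ} (M : Matrix (Config N w) (Config N w) ℂ) :
    Matrix (Fin (Nat.clog 2 N) → Bool) (Fin (Nat.clog 2 N) → Bool) ℂ :=
  Matrix.of fun s t => ∑ z : Fin w → Bool, ∑ A : Finset (Fin N),
    M (Sum.elim s z, A) (Sum.elim t z, A)

/-- The algorithm, run with black box `x ↦ S x`, implements `E` exactly: on input `ρ` in the system
register, with work qubits `|0…0⟩` and answer register `|∅⟩`, the system register ends up in the
state `E ρ` once everything else is traced out. -/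
def Implements {N w : ℕ} (S : Fin N → Finset (Fin N)) (alg : List (Step N w))
    (E : SuperOp N) : Prop :=
  ∀ ρ : Matrix (Fin N) (Fin N) ℂ,
    traceWork (runMatrix S alg *
        (inputIsometry N w * ρ * (inputIsometry N w).conjTranspose) *
        (runMatrix S alg).conjTranspose) =
      systemIsometry N * E ρ * (systemIsometry N).conjTranspose

end

end SparseStinespring

/-!
The black box reveals the cycle `A = S x` of the input. As `S y = S x` for all `y ∈ A`, a circuit
that stays inside `A` allows a second query to reset the answer register
(`exists_algorithm`). Since the gates may depend on `A`, everything reduces to one hard-coded circuit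
for each cycle `A`, which has to send `|x⟩|0⟩` to `V|x⟩` for the at most `d` elements `x` of `A`
(`exists_cycle_circuit`).

Mark the input `|x⟩` by a flag qubit, and let the outputs carry a second copy of `y` in one-hot form.
Then the inputs `u_x` and the outputs `v_x = V|x⟩` are together orthonormal, so the product of the
reflections about the *mirror vectors* `(u_x - v_x) / √2` exchanges them: the reflections commute, and
each of them only moves its own `u_x` and `v_x`. The mirror vector is prepared with `O(d (log N + k))`
gates, where `k` bounds the lengths of the given preparation circuits (`exists_prepare_mirror`): a superposition over the one-hot copy and the flag is followed, for
each `y`, by the controlled circuit of at most `k` gates that prepares the part of `V|x⟩` at `y`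
(`exists_superposition`). Control costs a constant factor, because every two-qubit gate becomes
diagonal after conjugation by a unitary, and only the diagonal part has to be controlled
(`exists_ctrl_gate`). At the end the one-hot copy is erased by comparing it with the system register.

A reflection is the preparation, undone and redone around a sign on the zero state
(`exists_reflection`), and testing for the zero state costs a constant number of gates for each qubit that is tested.
The ancilla has `m` qubits, where `m` is not bounded in terms of `d`, `log N` and `k`, so not all of
them can be tested. The `d ^ 2` preparation circuits of a cycle touch at most `2 * k` qubits each, and
`exists_coloring` colours the ancilla with `d * (2 * k) + 1` colours so that the qubits touched by any
one of the circuits have different colours. Let additional qubits contain the parities of the ancilla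
on all colour classes. For the reflection that belongs to `x`, take out of these parities the qubits
touched by its own circuits. If those qubits and the remaining parities are zero, then so is every
other ancilla qubit, as long as the ancilla is supported on the qubits touched by a single circuit,
which is the case for all states that occur. So `O(d (log N + k))` tests suffice for each of the `d`
reflections.

The resulting circuit for a cycle has at most `90 * d ^ 2 * (⌈log₂ N⌉ + k + 1)` gates
(`gate_count_bound`). With `k = K * c` and `N ≥ 2` this is at most `90 * (K + 5) * d ^ 2 * (log N + c)`.
For `N ≤ 1` the operation is the identity.
-/

namespace SparseStinespring

open Matrix Function

/-! ### The action of gates and circuits on state vectors -/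

section Gates

variable {ι : Type} [Fintype ι] [DecidableEq ι]

theorem toMatrix_one_mulVec (a : ι) (u : Matrix.unitaryGroup Bool ℂ) (v : (ι → Bool) → ℂ)
    (s : ι → Bool) :
    ((Gate.one a u).toMatrix *ᵥ v) s = ∑ x, u.1 (s a) x * v (update s a x) := by
  symm
  apply Fintype.sum_of_injective (fun x => update s a x)
  · intro x y h
    simpa using congrFun h a
  · intro t ht
    simp only [Gate.toMatrix, Matrix.of_apply]
    rw [if_neg, zero_mul]
    intro h
    refine ht ⟨t a, ?_⟩
    ext q
    by_cases hq : q = a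
    · subst hq; simp
    · simp [hq, h q hq]
  · intro x
    simp only [Gate.toMatrix, Matrix.of_apply]
    rw [if_pos]
    · simp
    · intro q hq; simp [hq]

theorem toMatrix_two_mulVec (a b : ι) (hab : a ≠ b) (u : Matrix.unitaryGroup (Bool × Bool) ℂ)
    (v : (ι → Bool) → ℂ) (s : ι → Bool) :
    ((Gate.two a b hab u).toMatrix *ᵥ v) s =
      ∑ x, u.1 (s a, s b) x * v (update (update s a x.1) b x.2) := by
  symm
  apply Fintype.sum_of_injective (fun x : Bool × Bool => update (update s a x.1) b x.2)
  · intro x y h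
    have h1 := congrFun h a
    have h2 := congrFun h b
    simp [hab] at h1 h2
    exact Prod.ext h1 h2
  · intro t ht
    simp only [Gate.toMatrix, Matrix.of_apply]
    rw [if_neg, zero_mul]
    intro h
    refine ht ⟨(t a, t b), ?_⟩
    ext q
    by_cases hq : q = b
    · subst hq; simp
    · by_cases hq' : q = a
      · subst hq'; simp [hq]
      · simp [hq, hq', h q hq' hq]
  · intro x
    simp only [Gate.toMatrix, Matrix.of_apply]
    rw [if_pos]
    · simp [hab]
    · intro q hq hq'; simp [hq, hq']

/-- The state into which a circuit turns the state `v`. -/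
noncomputable def run (gs : List (Gate ι)) (v : (ι → Bool) → ℂ) : (ι → Bool) → ℂ :=
  circuitMatrix gs *ᵥ v

@[simp] theorem run_nil (v : (ι → Bool) → ℂ) : run [] v = v := by
  simp [run, circuitMatrix]

theorem run_cons (g : Gate ι) (gs : List (Gate ι)) (v : (ι → Bool) → ℂ) :
    run (g :: gs) v = run gs (g.toMatrix *ᵥ v) := by
  simp [run, circuitMatrix]

theorem run_singleton (g : Gate ι) (v : (ι → Bool) → ℂ) : run [g] v = g.toMatrix *ᵥ v := by
  simp [run_cons]

theorem run_append (gs hs : List (Gate ι)) (v : (ι → Bool) → ℂ) :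
    run (gs ++ hs) v = run hs (run gs v) := by
  induction gs generalizing v with
  | nil => simp
  | cons g gs ih => simp [run_cons, ih]

theorem run_cons' (g : Gate ι) (gs : List (Gate ι)) (v : (ι → Bool) → ℂ) :
    run (g :: gs) v = run gs (run [g] v) := by
  rw [run_singleton, run_cons]

theorem run_add (gs : List (Gate ι)) (v w : (ι → Bool) → ℂ) :
    run gs (v + w) = run gs v + run gs w := Matrix.mulVec_add _ _ _

theorem run_sub (gs : List (Gate ι)) (v w : (ι → Bool) → ℂ) :
    run gs (v - w) = run gs v - run gs w := Matrix.mulVec_sub _ _ _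

theorem run_smul (gs : List (Gate ι)) (c : ℂ) (v : (ι → Bool) → ℂ) :
    run gs (c • v) = c • run gs v := Matrix.mulVec_smul _ _ _

theorem run_sum {κ : Type*} (gs : List (Gate ι)) (T : Finset κ) (v : κ → (ι → Bool) → ℂ) :
    run gs (∑ k ∈ T, v k) = ∑ k ∈ T, run gs (v k) := by
  classical
  induction T using Finset.induction_on with
  | empty => simp [run]
  | insert k T hk ih => simp [Finset.sum_insert hk, run_add, ih]

/-! ### Inverse circuits and unitarity -/

/-- The inverse of a gate. -/
def Gate.inv : Gate ι → Gate ι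
  | .one a u => .one a u⁻¹
  | .two a b h u => .two a b h u⁻¹

/-- The inverse of a circuit. -/
def invCircuit (gs : List (Gate ι)) : List (Gate ι) := (gs.map Gate.inv).reverse

omit [Fintype ι] [DecidableEq ι] in
@[simp] theorem length_invCircuit (gs : List (Gate ι)) :
    (invCircuit gs).length = gs.length := by simp [invCircuit]

theorem one_mul_mulVec (a : ι) (u w : Matrix.unitaryGroup Bool ℂ) (v : (ι → Bool) → ℂ) :
    (Gate.one a u).toMatrix *ᵥ ((Gate.one a w).toMatrix *ᵥ v) =
      (Gate.one a (u * w)).toMatrix *ᵥ v := by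
  ext s
  simp only [toMatrix_one_mulVec, update_idem, update_self, Finset.mul_sum,
    Submonoid.coe_mul, Matrix.mul_apply, Finset.sum_mul, mul_assoc]
  rw [Finset.sum_comm]

theorem two_mul_mulVec (a b : ι) (h : a ≠ b) (u w : Matrix.unitaryGroup (Bool × Bool) ℂ)
    (v : (ι → Bool) → ℂ) :
    (Gate.two a b h u).toMatrix *ᵥ ((Gate.two a b h w).toMatrix *ᵥ v) =
      (Gate.two a b h (u * w)).toMatrix *ᵥ v := by
  ext s
  have key : ∀ x y : Bool × Bool,
      update (update (update (update s a x.1) b x.2) a y.1) b y.2 =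
        update (update s a y.1) b y.2 := by
    intro x y
    rw [update_comm h.symm x.2 y.1 (update s a x.1), update_idem, update_idem]
  simp only [toMatrix_two_mulVec, key, update_self, Finset.mul_sum,
    Submonoid.coe_mul, Matrix.mul_apply, Finset.sum_mul, mul_assoc, update_of_ne h]
  rw [Finset.sum_comm]

theorem one_one_mulVec (a : ι) (v : (ι → Bool) → ℂ) :
    (Gate.one a 1).toMatrix *ᵥ v = v := by
  ext s
  simp [toMatrix_one_mulVec, Matrix.one_apply]

theorem two_one_mulVec (a b : ι) (h : a ≠ b) (v : (ι → Bool) → ℂ) :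
    (Gate.two a b h 1).toMatrix *ᵥ v = v := by
  ext s
  simp [toMatrix_two_mulVec, Matrix.one_apply]

theorem inv_mulVec_mulVec (g : Gate ι) (v : (ι → Bool) → ℂ) :
    g.inv.toMatrix *ᵥ (g.toMatrix *ᵥ v) = v := by
  cases g with
  | one a u => rw [Gate.inv, one_mul_mulVec, inv_mul_cancel, one_one_mulVec]
  | two a b h u => rw [Gate.inv, two_mul_mulVec, inv_mul_cancel, two_one_mulVec]

theorem mulVec_inv_mulVec (g : Gate ι) (v : (ι → Bool) → ℂ) :
    g.toMatrix *ᵥ (g.inv.toMatrix *ᵥ v) = v := by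
  cases g with
  | one a u => rw [Gate.inv, one_mul_mulVec, mul_inv_cancel, one_one_mulVec]
  | two a b h u => rw [Gate.inv, two_mul_mulVec, mul_inv_cancel, two_one_mulVec]

theorem conjTranspose_toMatrix (g : Gate ι) : g.toMatrixᴴ = g.inv.toMatrix := by
  ext s t
  cases g with
  | one a u =>
    simp only [Gate.toMatrix, Gate.inv, Matrix.conjTranspose_apply, Matrix.of_apply,
      apply_ite star, star_zero]
    refine if_congr ⟨fun h q hq => (h q hq).symm, fun h q hq => (h q hq).symm⟩ rfl rfl
  | two a b _ u =>
    simp only [Gate.toMatrix, Gate.inv, Matrix.conjTranspose_apply, Matrix.of_apply,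
      apply_ite star, star_zero]
    refine if_congr ⟨fun h q hq hq' => (h q hq hq').symm, fun h q hq hq' => (h q hq hq').symm⟩
      rfl rfl

theorem run_invCircuit_run (gs : List (Gate ι)) (v : (ι → Bool) → ℂ) :
    run (invCircuit gs) (run gs v) = v := by
  induction gs generalizing v with
  | nil => simp [invCircuit]
  | cons g gs ih =>
    have : invCircuit (g :: gs) = invCircuit gs ++ [g.inv] := by simp [invCircuit]
    rw [this, run_append, run_cons g gs, ih, run_singleton, inv_mulVec_mulVec]

theorem run_run_invCircuit (gs : List (Gate ι)) (v : (ι → Bool) → ℂ) :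
    run gs (run (invCircuit gs) v) = v := by
  induction gs generalizing v with
  | nil => simp [invCircuit]
  | cons g gs ih =>
    have : invCircuit (g :: gs) = invCircuit gs ++ [g.inv] := by simp [invCircuit]
    rw [this, run_append, run_cons, run_singleton, mulVec_inv_mulVec, ih]

/-- The inner product of two state vectors, antilinear in the first argument. -/
noncomputable def braket {κ : Type*} [Fintype κ] (v w : κ → ℂ) : ℂ := star v ⬝ᵥ w

theorem braket_run (gs : List (Gate ι)) (v w : (ι → Bool) → ℂ) :
    braket (run gs v) w = braket v (run (invCircuit gs) w) := by
  induction gs generalizing v w with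
  | nil => simp [invCircuit]
  | cons g gs ih =>
    have : invCircuit (g :: gs) = invCircuit gs ++ [g.inv] := by simp [invCircuit]
    rw [this, run_append, run_cons, ih, run_singleton, braket, braket, Matrix.star_mulVec,
      ← Matrix.dotProduct_mulVec, conjTranspose_toMatrix]

theorem braket_run_run (gs : List (Gate ι)) (v w : (ι → Bool) → ℂ) :
    braket (run gs v) (run gs w) = braket v w := by
  rw [braket_run, run_invCircuit_run]

/-! ### Locality -/

omit [Fintype ι] in
/-- The qubits a gate acts on. -/
def Gate.wires : Gate ι → Finset ι
  | .one a _ => {a}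
  | .two a b _ _ => {a, b}

/-- The qubits a circuit acts on. -/
def wires : List (Gate ι) → Finset ι
  | [] => ∅
  | g :: gs => g.wires ∪ wires gs

omit [Fintype ι] in
@[simp] theorem wires_nil : wires ([] : List (Gate ι)) = ∅ := rfl

omit [Fintype ι] in
theorem wires_cons (g : Gate ι) (gs : List (Gate ι)) : wires (g :: gs) = g.wires ∪ wires gs := rfl

omit [Fintype ι] in
theorem wires_append (gs hs : List (Gate ι)) : wires (gs ++ hs) = wires gs ∪ wires hs := by
  induction gs with
  | nil => simp
  | cons g gs ih => simp [wires_cons, ih, Finset.union_assoc]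

omit [Fintype ι] in
@[simp] theorem wires_inv (g : Gate ι) : g.inv.wires = g.wires := by
  cases g <;> rfl

omit [Fintype ι] in
@[simp] theorem wires_invCircuit (gs : List (Gate ι)) : wires (invCircuit gs) = wires gs := by
  induction gs with
  | nil => rfl
  | cons g gs ih =>
    have : invCircuit (g :: gs) = invCircuit gs ++ [g.inv] := by simp [invCircuit]
    rw [this, wires_append, ih, wires_cons, wires_cons, wires_inv, wires_nil, Finset.union_empty,
      Finset.union_comm]

omit [Fintype ι] in
theorem card_wires_le (gs : List (Gate ι)) : (wires gs).card ≤ 2 * gs.length := by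
  induction gs with
  | nil => simp
  | cons g gs ih =>
    have : g.wires.card ≤ 2 := by
      cases g with
      | one a u => simp [Gate.wires]
      | two a b h u => exact Finset.card_le_two
    rw [wires_cons]
    refine (Finset.card_union_le _ _).trans ?_
    simp only [List.length_cons]
    omega

theorem exists_of_toMatrix_mulVec_ne_zero (g : Gate ι) {v : (ι → Bool) → ℂ} {s : ι → Bool}
    (h : (g.toMatrix *ᵥ v) s ≠ 0) : ∃ t, v t ≠ 0 ∧ ∀ q ∉ g.wires, t q = s q := by
  cases g with
  | one a u =>
    rw [toMatrix_one_mulVec] at h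
    obtain ⟨x, -, hx⟩ := Finset.exists_ne_zero_of_sum_ne_zero h
    refine ⟨_, right_ne_zero_of_mul hx, fun q hq => ?_⟩
    simp only [Gate.wires, Finset.mem_singleton] at hq
    simp [hq]
  | two a b hab u =>
    rw [toMatrix_two_mulVec] at h
    obtain ⟨x, -, hx⟩ := Finset.exists_ne_zero_of_sum_ne_zero h
    refine ⟨_, right_ne_zero_of_mul hx, fun q hq => ?_⟩
    simp only [Gate.wires, Finset.mem_insert, Finset.mem_singleton, not_or] at hq
    simp [hq]

/-- A circuit changes no qubit it does not act on. -/
theorem exists_of_run_ne_zero (gs : List (Gate ι)) {v : (ι → Bool) → ℂ} {s : ι → Bool}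
    (h : run gs v s ≠ 0) : ∃ t, v t ≠ 0 ∧ ∀ q ∉ wires gs, t q = s q := by
  induction gs generalizing v with
  | nil => exact ⟨s, by simpa using h, fun _ _ => rfl⟩
  | cons g gs ih =>
    rw [run_cons] at h
    obtain ⟨t, ht, hts⟩ := ih h
    obtain ⟨t', ht', hts'⟩ := exists_of_toMatrix_mulVec_ne_zero g ht
    refine ⟨t', ht', fun q hq => ?_⟩
    rw [wires_cons, Finset.mem_union, not_or] at hq
    rw [hts' q hq.1, hts q hq.2]

/-- The value of `run gs v` at `s` depends only on the values of `v` at configurations that agree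
with `s` on the qubits `gs` does not act on. -/
theorem run_congr (gs : List (Gate ι)) {v w : (ι → Bool) → ℂ} {s : ι → Bool}
    (h : ∀ t, (∀ q ∉ wires gs, t q = s q) → v t = w t) : run gs v s = run gs w s := by
  rw [← sub_eq_zero, ← Pi.sub_apply, ← run_sub]
  by_contra hne
  obtain ⟨t, ht, hts⟩ := exists_of_run_ne_zero gs hne
  exact ht (sub_eq_zero.2 (h t hts))

/-! ### Circuits on part of the qubits -/

variable {κ : Type} [Fintype κ] [DecidableEq κ]

/-- The gate on the qubits `f q`, for an injective relabelling `f` of the qubits. -/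
def Gate.map {ι κ : Type} (f : κ → ι) (hf : Injective f) : Gate κ → Gate ι
  | .one a u => .one (f a) u
  | .two a b h u => .two (f a) (f b) (hf.ne h) u

open Classical in
/-- The state `v` on the qubits in the range of `f`, tensored with the basis state `c` of all other
qubits. -/
noncomputable def lift (f : κ → ι) (c : ι → Bool) (v : (κ → Bool) → ℂ) : (ι → Bool) → ℂ :=
  fun s => if ∀ q ∉ Set.range f, s q = c q then v (s ∘ f) else 0

theorem map_toMatrix_mulVec_lift (f : κ → ι) (hf : Injective f) (c : ι → Bool) (g : Gate κ)
    (v : (κ → Bool) → ℂ) :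
    (g.map f hf).toMatrix *ᵥ lift f c v = lift f c (g.toMatrix *ᵥ v) := by
  have hupd : ∀ (s : ι → Bool) (a : κ) (x : Bool), update s (f a) x ∘ f = update (s ∘ f) a x :=
    fun s a x => update_comp_eq_of_injective s hf a x
  have hcond : ∀ (s : ι → Bool) (a : κ) (x : Bool),
      (∀ q ∉ Set.range f, update s (f a) x q = c q) ↔ ∀ q ∉ Set.range f, s q = c q := by
    intro s a x
    refine forall₂_congr fun q hq => ?_
    rw [update_of_ne]
    rintro rfl
    exact hq ⟨a, rfl⟩
  ext s
  cases g with
  | one a u =>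
    simp only [Gate.map, toMatrix_one_mulVec, lift, hcond, hupd]
    split_ifs <;> simp
  | two a b h u =>
    simp only [Gate.map, toMatrix_two_mulVec, lift, hcond, hupd]
    split_ifs <;> simp

theorem run_map_lift (f : κ → ι) (hf : Injective f) (c : ι → Bool) (gs : List (Gate κ))
    (v : (κ → Bool) → ℂ) :
    run (gs.map (Gate.map f hf)) (lift f c v) = lift f c (run gs v) := by
  induction gs generalizing v with
  | nil => simp
  | cons g gs ih => rw [List.map_cons, run_cons, map_toMatrix_mulVec_lift, ih, run_cons]

omit [Fintype ι] [Fintype κ] in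
theorem wires_map (f : κ → ι) (hf : Injective f) (gs : List (Gate κ)) :
    wires (gs.map (Gate.map f hf)) = (wires gs).image f := by
  induction gs with
  | nil => rfl
  | cons g gs ih =>
    rw [List.map_cons, wires_cons, wires_cons, Finset.image_union, ih]
    congr 1
    cases g <;> simp [Gate.map, Gate.wires, Finset.image_insert]

end Gates

/-! ### Diagonalization of unitary matrices -/

/-- A linear isometry of a finite-dimensional complex inner product space has an orthonormal basis
of eigenvectors: the orthogonal complement of a maximal orthonormal set of eigenvectors is invariant,
and it would contain a further eigenvector if it were not zero. -/
theorem exists_orthonormalBasis_eigenvectors {E n : Type*} [NormedAddCommGroup E]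
    [InnerProductSpace ℂ E] [FiniteDimensional ℂ E] [Fintype n]
    (hn : Fintype.card n = Module.finrank ℂ E) (T : E →ₗ[ℂ] E)
    (hT : ∀ x y, inner ℂ (T x) (T y) = inner ℂ x y) :
    ∃ (b : OrthonormalBasis n ℂ E) (μ : n → ℂ), ∀ i, T (b i) = μ i • b i := by
  classical
  have hz : ∃ S, Maximal (fun S : Set E => Orthonormal ℂ (Subtype.val : S → E) ∧
      ∀ v ∈ S, ∃ μ : ℂ, T v = μ • v) S := by
    refine zorn_subset {S | _} fun c hc hcc => ⟨⋃₀ c, ⟨?_, ?_⟩, fun _ => Set.subset_sUnion_of_mem⟩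
    · exact orthonormal_sUnion_of_directed hcc.directedOn fun x hx => (hc hx).1
    · rintro v ⟨S, hS, hv⟩
      exact (hc hS).2 v hv
  obtain ⟨S, ⟨hS, hSe⟩, hmax⟩ := hz
  have hK : (Submodule.span ℂ S)ᗮ = ⊥ := by
    by_contra hne
    have hinv : ∀ x ∈ (Submodule.span ℂ S)ᗮ, T x ∈ (Submodule.span ℂ S)ᗮ := by
      intro x hx
      rw [Submodule.mem_orthogonal]
      intro y hy
      induction hy using Submodule.span_induction with
      | zero => simp
      | add y z _ _ hy hz => rw [inner_add_left, hy, hz, add_zero]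
      | smul a y _ hy => rw [inner_smul_left, hy, mul_zero]
      | mem v hv =>
        obtain ⟨μ, hμ⟩ := hSe v hv
        have hvx : inner ℂ v x = 0 := hx v (Submodule.subset_span hv)
        have h1 : inner ℂ (T v) (T x) = 0 := by rw [hT, hvx]
        rw [hμ, inner_smul_left] at h1
        rcases mul_eq_zero.1 h1 with h | h
        · have h2 := hT v v
          rw [hμ, inner_smul_left, h, zero_mul] at h2
          exact absurd (inner_self_eq_zero.1 h2.symm) (hS.ne_zero ⟨v, hv⟩)
        · exact h
    have : Nontrivial (Submodule.span ℂ S)ᗮ := Submodule.nontrivial_iff_ne_bot.2 hne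
    -- A unit eigenvector in the complement extends `S`, against maximality.
    obtain ⟨μ, hμ⟩ := Module.End.exists_eigenvalue (T.restrict hinv)
    obtain ⟨⟨x, hx⟩, hx'⟩ := hμ.exists_hasEigenvector
    have hx0 : x ≠ 0 := fun h => hx'.2 (Subtype.ext h)
    have hTx : T x = μ • x := congrArg Subtype.val hx'.apply_eq_smul
    set e : E := ((‖x‖ : ℂ)⁻¹) • x with he
    have hen : ‖e‖ = 1 := by
      simpa [he] using (norm_smul_inv_norm (𝕜 := ℂ) hx0)
    have hvx : ∀ v ∈ S, inner ℂ v e = 0 := fun v hv => by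
      rw [he, inner_smul_right, hx v (Submodule.subset_span hv), mul_zero]
    have heS : e ∉ S := by
      intro h
      have := hvx e h
      rw [inner_self_eq_zero] at this
      rw [this] at hen
      simp at hen
    refine heS (hmax (y := insert e S) ⟨?_, ?_⟩ (Set.subset_insert _ _) (Set.mem_insert _ _))
    · rw [orthonormal_subtype_iff_ite] at hS ⊢
      intro v hv w hw
      rcases hv with rfl | hv <;> rcases hw with rfl | hw
      · rw [if_pos rfl, inner_self_eq_norm_sq_to_K, hen]; simp
      · rw [if_neg (by rintro rfl; exact heS hw), ← inner_conj_symm, hvx w hw, map_zero]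
      · rw [if_neg (by rintro rfl; exact heS hv), hvx v hv]
      · exact hS v hv w hw
    · rintro v (rfl | hv)
      · exact ⟨μ, by rw [he, map_smul, hTx, smul_comm]⟩
      · exact hSe v hv
  have hspan : Submodule.span ℂ (Set.range (Subtype.val : S → E)) = ⊤ := by
    rw [Subtype.range_coe, ← Submodule.orthogonal_eq_bot_iff, hK]
  have hfin : Fintype S := @Fintype.ofFinite _ hS.linearIndependent.finite
  let b₀ : OrthonormalBasis S ℂ E := OrthonormalBasis.mk hS hspan.ge
  have hcard : Fintype.card S = Fintype.card n := by
    rw [hn, Module.finrank_eq_card_basis b₀.toBasis]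
  let b := b₀.reindex (Fintype.equivOfCardEq hcard)
  have hb : ∀ i, ∃ μ : ℂ, T (b i) = μ • b i := by
    intro i
    have : b i = ((Fintype.equivOfCardEq hcard).symm i : E) := by
      simp [b, b₀]
    rw [this]
    exact hSe _ (Subtype.coe_prop _)
  choose μ hμ using hb
  exact ⟨b, μ, hμ⟩

/-- The spectral theorem for unitary matrices. -/
theorem exists_unitary_diagonalization {n : Type*} [Fintype n] [DecidableEq n]
    (u : Matrix.unitaryGroup n ℂ) :
    ∃ (w : Matrix.unitaryGroup n ℂ) (d : n → ℂ) (hd : Matrix.diagonal d ∈ Matrix.unitaryGroup n ℂ),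
      (∀ i, ‖d i‖ = 1) ∧ u = w * ⟨Matrix.diagonal d, hd⟩ * w⁻¹ := by
  have hT : ∀ x y : EuclideanSpace ℂ n, inner ℂ (Matrix.toEuclideanLin u.1 x)
      (Matrix.toEuclideanLin u.1 y) = inner ℂ x y := by
    intro x y
    rw [EuclideanSpace.inner_eq_star_dotProduct, EuclideanSpace.inner_eq_star_dotProduct]
    simp only [Matrix.toLpLin_apply]
    rw [Matrix.star_mulVec, dotProduct_comm, ← Matrix.dotProduct_mulVec, Matrix.mulVec_mulVec,
      ← Matrix.star_eq_conjTranspose, Unitary.coe_star_mul_self, Matrix.one_mulVec,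
      dotProduct_comm]
  obtain ⟨b, μ, hμ⟩ := exists_orthonormalBasis_eigenvectors (n := n) (by simp) _ hT
  let w : Matrix.unitaryGroup n ℂ :=
    ⟨(EuclideanSpace.basisFun n ℂ).toBasis.toMatrix b.toBasis,
      (EuclideanSpace.basisFun n ℂ).toMatrix_orthonormalBasis_mem_unitary b⟩
  have hw : u.1 * w.1 = w.1 * Matrix.diagonal μ := by
    ext i j
    have h := congrArg (fun x : EuclideanSpace ℂ n => x i) (hμ j)
    have hwb : ∀ i j, w.1 i j = b j i := fun _ _ => rfl
    rw [Matrix.mul_diagonal, Matrix.mul_apply]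
    simp only [hwb]
    simpa [Matrix.toLpLin_apply, Matrix.mulVec, dotProduct, mul_comm] using h
  have hd : Matrix.diagonal μ = (w⁻¹ * u * w).1 := by
    have : (w⁻¹ * u * w).1 = w⁻¹.1 * (u.1 * w.1) := by
      simp [Matrix.mul_assoc]
    rw [this, hw, ← Matrix.mul_assoc]
    have : w⁻¹.1 * w.1 = 1 := congrArg Subtype.val (inv_mul_cancel w)
    rw [this, Matrix.one_mul]
  have hmem : Matrix.diagonal μ ∈ Matrix.unitaryGroup n ℂ := hd ▸ (w⁻¹ * u * w).2
  refine ⟨w, μ, hmem, ?_, ?_⟩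
  · intro i
    have h := (Matrix.mem_unitaryGroup_iff.1 hmem)
    have h := congrFun (congrFun h i) i
    rw [Matrix.star_eq_conjTranspose, Matrix.diagonal_conjTranspose, Matrix.diagonal_mul_diagonal,
      Matrix.diagonal_apply_eq, Matrix.one_apply_eq, Pi.star_apply] at h
    have h2 : ((‖μ i‖ ^ 2 : ℝ) : ℂ) = 1 := by
      rw [← h]; push_cast
      exact (Complex.mul_conj' _).symm
    have h3 : ‖μ i‖ ^ 2 = 1 := by exact_mod_cast h2
    exact (pow_eq_one_iff_of_nonneg (norm_nonneg _) two_ne_zero).1 h3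
  · have : (⟨Matrix.diagonal μ, hmem⟩ : Matrix.unitaryGroup n ℂ) = w⁻¹ * u * w := Subtype.ext hd
    rw [this]
    group

/-! ### Elementary gates -/

section Elementary

variable {ι : Type} [Fintype ι] [DecidableEq ι]

/-- The unitary that permutes the basis states: its value on a vector `v` is `v ∘ σ`. -/
def permUnitary {n : Type} [Fintype n] [DecidableEq n] (σ : Equiv.Perm n) :
    Matrix.unitaryGroup n ℂ :=
  ⟨Matrix.of fun i j => if j = σ i then 1 else 0, by
    rw [Matrix.mem_unitaryGroup_iff]
    ext i k
    simp [Matrix.mul_apply, Matrix.one_apply, eq_comm]⟩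

/-- The diagonal unitary with the given phases. -/
def diagUnitary {n : Type} [Fintype n] [DecidableEq n] (d : n → ℂ) (hd : ∀ i, ‖d i‖ = 1) :
    Matrix.unitaryGroup n ℂ :=
  ⟨Matrix.diagonal d, by
    rw [Matrix.mem_unitaryGroup_iff, Matrix.star_eq_conjTranspose,
      Matrix.diagonal_conjTranspose, Matrix.diagonal_mul_diagonal, ← Matrix.diagonal_one]
    congr 1
    ext i
    simp [Complex.mul_conj', hd]⟩

/-- The permutation `(x, y) ↦ (x, f x ⊕ y)` of two bits. -/
def xorPerm (f : Bool → Bool) : Equiv.Perm (Bool × Bool) where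
  toFun p := (p.1, xor (f p.1) p.2)
  invFun p := (p.1, xor (f p.1) p.2)
  left_inv p := by simp
  right_inv p := by simp

/-- The gate that flips one bit. -/
def notGate (a : ι) : Gate ι := .one a (permUnitary Equiv.boolNot)

/-- The gate that adds `f` of the bit `a` to the bit `b`. -/
def xorGate (f : Bool → Bool) (a b : ι) (h : a ≠ b) : Gate ι := .two a b h (permUnitary (xorPerm f))

theorem notGate_mulVec (a : ι) (v : (ι → Bool) → ℂ) (s : ι → Bool) :
    ((notGate a).toMatrix *ᵥ v) s = v (update s a (!s a)) := by
  simp [notGate, toMatrix_one_mulVec, permUnitary, ite_mul]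

theorem xorGate_mulVec (f : Bool → Bool) (a b : ι) (h : a ≠ b) (v : (ι → Bool) → ℂ)
    (s : ι → Bool) :
    ((xorGate f a b h).toMatrix *ᵥ v) s = v (update s b (xor (f (s a)) (s b))) := by
  rw [xorGate, toMatrix_two_mulVec, Finset.sum_eq_single (s a, xor (f (s a)) (s b))]
  · simp [permUnitary, xorPerm]
  · intro x _ hx
    simp [permUnitary, xorPerm, hx]
  · simp

theorem diagUnitary_one_mulVec (a : ι) (d : Bool → ℂ) (hd : ∀ i, ‖d i‖ = 1)
    (v : (ι → Bool) → ℂ) (s : ι → Bool) :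
    ((Gate.one a (diagUnitary d hd)).toMatrix *ᵥ v) s = d (s a) * v s := by
  simp [toMatrix_one_mulVec, diagUnitary, Matrix.diagonal_apply, ite_mul]

theorem diagUnitary_two_mulVec (a b : ι) (h : a ≠ b) (d : Bool × Bool → ℂ) (hd : ∀ i, ‖d i‖ = 1)
    (v : (ι → Bool) → ℂ) (s : ι → Bool) :
    ((Gate.two a b h (diagUnitary d hd)).toMatrix *ᵥ v) s = d (s a, s b) * v s := by
  simp [toMatrix_two_mulVec, diagUnitary, Matrix.diagonal_apply, ite_mul]

/-! ### Controlled gates -/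

/-- Every function from two bits to the unit circle is a product of a constant, a character of each
bit, and a character of their sum. -/
theorem exists_phases_eq (d : Bool × Bool → ℂ) (hd : ∀ i, ‖d i‖ = 1) :
    ∃ z : Fin 4 → ℂ, (∀ i, ‖z i‖ = 1) ∧ ∀ x y : Bool,
      d (x, y) = z 0 * (if x then z 1 else 1) * (if y then z 2 else 1) *
        (if xor x y then z 3 else 1) := by
  have hθ : ∀ p, ∃ θ : ℝ, d p = Complex.exp (θ * Complex.I) := fun p =>
    ⟨(d p).arg, by simpa [hd p] using (Complex.norm_mul_exp_arg_mul_I (d p)).symm⟩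
  choose θ hθ using hθ
  set a := θ (false, false)
  set b := θ (false, true)
  set c := θ (true, false)
  set e := θ (true, true)
  -- The exponents solve the four linear equations at `(x, y)`, with value `a` at `(0, 0)`.
  let t : Fin 4 → ℝ := ![a, (e - a + (c - a) - (b - a)) / 2, (e - a + (b - a) - (c - a)) / 2,
    (c - a + (b - a) - (e - a)) / 2]
  refine ⟨fun i => Complex.exp (t i * Complex.I), fun i => Complex.norm_exp_ofReal_mul_I _, ?_⟩
  intro x y
  rw [hθ]
  cases x <;> cases y <;> simp [t, ← Complex.exp_add] <;> congr 1 <;> ring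

/-- The characters of the single bits become controlled phases. The character of the sum is applied
to the qubit `b` while that qubit contains the sum. -/
theorem exists_ctrl_diag (q a b : ι) (hab : a ≠ b) (hqa : q ≠ a) (hqb : q ≠ b)
    (d : Bool × Bool → ℂ) (hd : ∀ i, ‖d i‖ = 1) :
    ∃ gs : List (Gate ι), gs.length ≤ 5 ∧ wires gs ⊆ {q, a, b} ∧
      ∀ v s, run gs v s = if s q then d (s a, s b) * v s else v s := by
  obtain ⟨z, hz, hdz⟩ := exists_phases_eq d hd
  let D1 : Bool × Bool → ℂ := fun p => if p.1 then z 0 * (if p.2 then z 1 else 1) else 1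
  let D2 : Bool × Bool → ℂ := fun p => if p.1 && p.2 then z 2 else 1
  let D3 : Bool × Bool → ℂ := fun p => if p.1 && p.2 then z 3 else 1
  have h1 : ∀ i, ‖D1 i‖ = 1 := by rintro ⟨x, y⟩; cases x <;> cases y <;> simp [D1, hz]
  have h2 : ∀ i, ‖D2 i‖ = 1 := by rintro ⟨x, y⟩; cases x <;> cases y <;> simp [D2, hz]
  have h3 : ∀ i, ‖D3 i‖ = 1 := by rintro ⟨x, y⟩; cases x <;> cases y <;> simp [D3, hz]
  refine ⟨[.two q a hqa (diagUnitary D1 h1), .two q b hqb (diagUnitary D2 h2), xorGate id a b hab,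
    .two q b hqb (diagUnitary D3 h3), xorGate id a b hab], by simp, ?_, ?_⟩
  · intro w hw
    simp [wires_cons, Gate.wires, xorGate] at hw ⊢
    tauto
  · intro v s
    simp only [run_cons, run_nil, xorGate_mulVec, diagUnitary_two_mulVec]
    have e1 : update (update s b (xor (id (s a)) (s b))) b
        (xor (id (update s b (xor (id (s a)) (s b)) a)) (update s b (xor (id (s a)) (s b)) b)) =
          s := by
      simp [hab]
    rw [e1]
    simp only [update_self, update_of_ne hqb, hdz, D1, D2, D3, id]
    cases s q <;> cases s a <;> cases s b <;> simp <;> ring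

/-- A controlled two-qubit gate `w * diagonal d * w⁻¹` needs control only on the diagonal factor: if the
control is zero, then `w⁻¹` and `w` cancel. -/
theorem exists_ctrl_gate (q : ι) (g : Gate ι) (hq : q ∉ g.wires) :
    ∃ gs : List (Gate ι), gs.length ≤ 7 ∧ wires gs ⊆ insert q g.wires ∧
      ∀ v s, run gs v s = if s q then run [g] v s else v s := by
  cases g with
  | one a u =>
    have hqa : q ≠ a := by simpa [Gate.wires] using hq
    have h1 := Matrix.mem_unitaryGroup_iff.1 u.2
    have h1' : ∀ x y, u.1 x true * star (u.1 y true) + u.1 x false * star (u.1 y false) =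
        if x = y then 1 else 0 := by
      intro x y
      have := congrFun (congrFun h1 x) y
      simpa [Matrix.mul_apply, Matrix.one_apply] using this
    let U : Matrix (Bool × Bool) (Bool × Bool) ℂ := Matrix.of fun p r =>
      if p.1 = r.1 then (if p.1 then u.1 p.2 r.2 else if p.2 = r.2 then 1 else 0) else 0
    have hU : U ∈ Matrix.unitaryGroup (Bool × Bool) ℂ := by
      rw [Matrix.mem_unitaryGroup_iff]
      ext ⟨x, y⟩ ⟨x', y'⟩
      have := h1' y y'
      rw [Matrix.mul_apply]
      simp only [Fintype.sum_prod_type, Fintype.sum_bool, Matrix.star_apply, U, Matrix.of_apply,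
        Matrix.one_apply, Prod.mk.injEq]
      cases x <;> cases x' <;> simp
      · cases y <;> cases y' <;> simp
      · simpa using this
    refine ⟨[.two q a hqa ⟨U, hU⟩], by simp, by simp [wires_cons, Gate.wires], ?_⟩
    intro v s
    simp only [run_singleton, toMatrix_one_mulVec, toMatrix_two_mulVec, Fintype.sum_prod_type, U]
    cases h : s q
    · have e : update s q false = s := by rw [← h, update_eq_self]
      have e' : update s a (s a) = s := update_eq_self _ _
      cases h' : s a <;> rw [h'] at e' <;> simp [e, e']
    · have e : update s q true = s := by rw [← h, update_eq_self]
      simp [e]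
  | two a b hab u =>
    have hqa : q ≠ a := by rintro rfl; simp [Gate.wires] at hq
    have hqb : q ≠ b := by rintro rfl; simp [Gate.wires] at hq
    obtain ⟨w, d, hd, hd', hu⟩ := exists_unitary_diagonalization u
    obtain ⟨gs, hlen, hw, hrun⟩ := exists_ctrl_diag q a b hab hqa hqb d hd'
    refine ⟨.two a b hab w⁻¹ :: (gs ++ [.two a b hab w]), by simp; omega, ?_, ?_⟩
    · intro r hr
      have := @hw r
      simp [wires_cons, wires_append, Gate.wires] at hr this ⊢
      tauto
    · intro v s
      have hD : (⟨Matrix.diagonal d, hd⟩ : Matrix.unitaryGroup _ ℂ) = diagUnitary d hd' := rfl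
      rw [run_cons, run_append, run_singleton, run_singleton]
      rw [toMatrix_two_mulVec]
      simp only [hrun, update_of_ne hqa, update_of_ne hqb]
      cases hs : s q
      · simp only [Bool.false_eq_true, if_false]
        rw [← toMatrix_two_mulVec a b hab w, two_mul_mulVec, mul_inv_cancel,
          two_one_mulVec]
      · simp only [if_true]
        have : ((Gate.two a b hab u).toMatrix *ᵥ v) s = ((Gate.two a b hab w).toMatrix *ᵥ
            ((Gate.two a b hab (diagUnitary d hd')).toMatrix *ᵥ
              ((Gate.two a b hab w⁻¹).toMatrix *ᵥ v))) s := by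
          rw [two_mul_mulVec, two_mul_mulVec, hu, hD]
        rw [this, toMatrix_two_mulVec]
        simp only [diagUnitary_two_mulVec]

/-- Adding a control qubit to a circuit costs a constant factor. -/
theorem exists_ctrl_circuit (q : ι) (gs : List (Gate ι)) (hq : q ∉ wires gs) :
    ∃ hs : List (Gate ι), hs.length ≤ 7 * gs.length ∧ wires hs ⊆ insert q (wires gs) ∧
      ∀ v s, run hs v s = if s q then run gs v s else v s := by
  induction gs with
  | nil => exact ⟨[], by simp⟩
  | cons g gs ih =>
    rw [wires_cons, Finset.mem_union, not_or] at hq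
    obtain ⟨hs, hlen, hw, hrun⟩ := ih hq.2
    obtain ⟨g', hlen', hw', hrun'⟩ := exists_ctrl_gate q g hq.1
    refine ⟨g' ++ hs, by simp; omega, ?_, ?_⟩
    · rw [wires_append, wires_cons]
      intro r hr
      have := @hw r
      have := @hw' r
      simp at *
      tauto
    · intro v s
      rw [run_append, hrun, run_cons' g gs]
      cases hs : s q
      · simp [hrun', hs]
      · simp only [if_true]
        refine run_congr gs fun t ht => ?_
        rw [hrun', ht q hq.2, hs, if_pos rfl]

end Elementary

/-! ### Operations conditioned on many qubits being zero -/

section ZeroTest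

variable {ι : Type} [Fintype ι] [DecidableEq ι]

/-- The qubits of `ks` are zero in the state `v`. -/
def CleanOn (ks : List ι) (v : (ι → Bool) → ℂ) : Prop :=
  ∀ s, v s ≠ 0 → ∀ k ∈ ks, s k = false

/-- The conjunction of `s p` and `¬ s z` is added to the qubit `k`. -/
theorem exists_toffoli (p z k : ι) (hpz : p ≠ z) (hpk : p ≠ k) (hzk : z ≠ k) :
    ∃ gs : List (Gate ι), gs.length ≤ 7 ∧
      ∀ v s, run gs v s = v (update s k (xor (s p && !s z) (s k))) := by
  obtain ⟨gs, hlen, -, hrun⟩ := exists_ctrl_gate p (xorGate not z k hzk)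
    (by simp [xorGate, Gate.wires, hpz, hpk])
  refine ⟨gs, hlen, fun v s => ?_⟩
  rw [hrun, run_singleton, xorGate_mulVec]
  cases h : s p <;> simp

/-- The conjunction of the tests of `p` and of the qubits `zs` is accumulated in the clean qubits
`ks`, the conditional operation is applied under the control of the last one, and the conjunctions
are erased again. -/
theorem exists_conditional_of_control (base : ι → List (Gate ι)) (L : ℕ)
    (σ : (ι → Bool) → (ι → Bool)) (ε : ℂ) (zs : List ι) (p : ι) (ks : List ι)
    (hlen : zs.length ≤ ks.length) (hnd : (p :: ks).Nodup) (hdisj : ∀ z ∈ zs, z ∉ p :: ks)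
    (hL : ∀ k, (base k).length ≤ L)
    (hbase : ∀ k ∈ p :: ks, ∀ v s, run (base k) v s = if s k then ε * v (σ s) else v s)
    (hσ : ∀ k ∈ ks, ∀ s b, σ (update s k b) = update (σ s) k b)
    (hσk : ∀ k ∈ p :: ks, ∀ s, σ s k = s k) (hσz : ∀ z ∈ zs, ∀ s, σ s z = s z) :
    ∃ gs : List (Gate ι), gs.length ≤ 14 * zs.length + L ∧
      ∀ v, CleanOn ks v → ∀ s, run gs v s =
        if s p = true ∧ ∀ z ∈ zs, s z = false then ε * v (σ s) else v s := by
  induction zs generalizing p ks with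
  | nil => exact ⟨base p, by simpa using hL p, fun v _ s => by simp [hbase p (by simp)]⟩
  | cons z zs ih =>
    cases ks with
    | nil => simp at hlen
    | cons k ks =>
      have hpk : p ≠ k := by rintro rfl; simp at hnd
      have hz : z ≠ p ∧ z ≠ k := by
        have := hdisj z (by simp)
        simp at this
        tauto
      obtain ⟨gs, hgl, hgr⟩ := ih k ks (by simpa using hlen) (List.nodup_cons.1 hnd).2
        (fun y hy hk => hdisj y (by simp [hy]) (List.mem_cons_of_mem _ hk))
        (fun j hj => hbase j (List.mem_cons_of_mem _ hj))
        (fun j hj => hσ j (List.mem_cons_of_mem _ hj))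
        (fun j hj => hσk j (List.mem_cons_of_mem _ hj))
        (fun y hy => hσz y (by simp [hy]))
      obtain ⟨T, hTl, hTr⟩ := exists_toffoli p z k hz.1.symm hpk hz.2
      refine ⟨T ++ gs ++ T, by simp; omega, fun v hv s => ?_⟩
      have hk : k ∉ ks := (List.nodup_cons.1 (List.nodup_cons.1 hnd).2).1
      have hzs : ∀ y ∈ zs, y ≠ k := fun y hy h => hdisj y (by simp [hy]) (by simp [h])
      have hclean : CleanOn ks (run T v) := by
        intro t ht j hj
        rw [hTr] at ht
        have := hv _ ht j (by simp [hj])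
        rwa [update_of_ne (by rintro rfl; exact hk hj)] at this
      rw [run_append, run_append, hTr, hgr _ hclean, hTr, hTr]
      have hcond : (∀ y ∈ zs, update s k (xor (s p && !s z) (s k)) y = false) ↔
          ∀ y ∈ zs, s y = false :=
        forall₂_congr fun y hy => by rw [update_of_ne (hzs y hy)]
      have hback : ∀ t : ι → Bool, t p = s p → t z = s z → t k = s k →
          update (update t k (xor (s p && !s z) (s k))) k
          (xor (update t k (xor (s p && !s z) (s k)) p &&
            !update t k (xor (s p && !s z) (s k)) z)
            (update t k (xor (s p && !s z) (s k)) k)) = t := by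
        intro t h1 h2 h3
        rw [update_idem, update_of_ne hpk, update_of_ne hz.2, update_self, h1, h2,
          ← Bool.xor_assoc, Bool.xor_self, Bool.false_xor, ← h3, update_eq_self]
      rw [hσ k (by simp), hback s rfl rfl rfl, hback (σ s) (hσk p (by simp) s)
        (hσz z (by simp) s) (hσk k (by simp) s), update_self]
      simp only [hcond]
      -- For `s k = 1` both sides vanish, because `k` is clean.
      by_cases hsk : s k = true
      · have h0 : v s = 0 := by
          by_contra h
          have := hv s h k (by simp)
          simp [hsk] at this
        have h1 : v (σ s) = 0 := by
          by_contra h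
          have := hv _ h k (by simp)
          rw [hσk k (by simp), hsk] at this
          simp at this
        simp [h0, h1]
      · simp only [Bool.not_eq_true] at hsk
        refine if_congr ?_ rfl rfl
        simp [hsk, and_assoc]

/-- A conditional operation, applied when all qubits of `zs` are zero. -/
theorem exists_conditional (base : ι → List (Gate ι)) (L : ℕ)
    (σ : (ι → Bool) → (ι → Bool)) (ε : ℂ) (zs : List ι) (ks : List ι)
    (hlen : zs.length < ks.length) (hnd : ks.Nodup) (hdisj : ∀ z ∈ zs, z ∉ ks)
    (hL : ∀ k, (base k).length ≤ L)
    (hbase : ∀ k ∈ ks, ∀ v s, run (base k) v s = if s k then ε * v (σ s) else v s)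
    (hσ : ∀ k ∈ ks, ∀ s b, σ (update s k b) = update (σ s) k b)
    (hσk : ∀ k ∈ ks, ∀ s, σ s k = s k) (hσz : ∀ z ∈ zs, ∀ s, σ s z = s z) :
    ∃ gs : List (Gate ι), gs.length ≤ 14 * zs.length + L + 2 ∧
      ∀ v, CleanOn ks v → ∀ s, run gs v s =
        if ∀ z ∈ zs, s z = false then ε * v (σ s) else v s := by
  cases ks with
  | nil => simp at hlen
  | cons p ks =>
    obtain ⟨gs, hgl, hgr⟩ := exists_conditional_of_control base L σ ε zs p ks
      (by simpa [Nat.lt_succ_iff] using hlen) hnd hdisj hL hbase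
      (fun k hk => hσ k (List.mem_cons_of_mem _ hk)) hσk hσz
    have hp : p ∉ ks := (List.nodup_cons.1 hnd).1
    -- The first chain qubit `p` is raised to represent the empty conjunction.
    refine ⟨notGate p :: (gs ++ [notGate p]), by simp; omega, fun v hv s => ?_⟩
    have hclean : CleanOn ks ((notGate p).toMatrix *ᵥ v) := by
      intro t ht j hj
      rw [notGate_mulVec] at ht
      have := hv _ ht j (by simp [hj])
      rwa [update_of_ne (by rintro rfl; exact hp hj)] at this
    rw [run_cons, run_append, run_singleton, notGate_mulVec, hgr _ hclean, notGate_mulVec,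
      notGate_mulVec]
    have hcond : (∀ y ∈ zs, update s p (!s p) y = false) ↔ ∀ y ∈ zs, s y = false :=
      forall₂_congr fun y hy => by
        rw [update_of_ne (by rintro rfl; exact hdisj _ hy (by simp))]
    rw [hσ p (by simp), update_idem, update_idem, update_self, update_self, Bool.not_not,
      update_eq_self]
    simp only [hcond]
    have h2 : update (σ s) p (s p) = σ s := by
      rw [← hσk p (by simp) s, update_eq_self]
    rw [h2]
    by_cases hsk : s p = true
    · have h0 : v s = 0 := by
        by_contra h
        have := hv s h p (by simp)
        simp [hsk] at this
      have h1 : v (σ s) = 0 := by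
        by_contra h
        have := hv _ h p (by simp)
        rw [hσk p (by simp), hsk] at this
        simp at this
      simp [h0, h1]
    · simp [hsk]

/-- The phase `-1` on the configurations in which all qubits of `zs` are zero. -/
theorem exists_zero_phase (zs ks : List ι) (hlen : zs.length < ks.length) (hnd : ks.Nodup)
    (hdisj : ∀ z ∈ zs, z ∉ ks) :
    ∃ gs : List (Gate ι), gs.length ≤ 14 * zs.length + 3 ∧
      ∀ v, CleanOn ks v → ∀ s, run gs v s = if ∀ z ∈ zs, s z = false then -v s else v s := by
  have hd : ∀ i, ‖(fun x : Bool => if x then (-1 : ℂ) else 1) i‖ = 1 := by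
    intro i; cases i <;> simp
  obtain ⟨gs, h1, h2⟩ := exists_conditional (fun k => [.one k (diagUnitary _ hd)]) 1 id (-1) zs ks
    hlen hnd hdisj (by simp)
    (fun k _ v s => by
      rw [run_singleton, diagUnitary_one_mulVec]
      split_ifs <;> simp)
    (by simp) (by simp) (by simp)
  exact ⟨gs, by omega, fun v hv s => by simpa using h2 v hv s⟩

/-- A flip of the qubit `τ` in the configurations in which all qubits of `zs` are zero. -/
theorem exists_zero_flip (τ : ι) (zs ks : List ι) (hlen : zs.length < ks.length) (hnd : ks.Nodup)
    (hdisj : ∀ z ∈ zs, z ∉ ks) (hτ : τ ∉ ks) (hτz : τ ∉ zs) :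
    ∃ gs : List (Gate ι), gs.length ≤ 14 * zs.length + 3 ∧
      ∀ v, CleanOn ks v → ∀ s, run gs v s =
        if ∀ z ∈ zs, s z = false then v (update s τ (!s τ)) else v s := by
  have hne : ∀ k ∈ ks, k ≠ τ := by rintro k hk rfl; exact hτ hk
  obtain ⟨gs, h1, h2⟩ := exists_conditional
    (fun k => if h : k ≠ τ then [xorGate id k τ h] else []) 1 (fun s => update s τ (!s τ)) 1 zs ks
    hlen hnd hdisj (fun k => by split_ifs <;> simp)
    (fun k hk v s => by
      simp only [hne k hk, ne_eq, not_false_eq_true, dite_true, run_singleton, xorGate_mulVec]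
      cases s k <;> simp)
    (fun k hk s b => by
      rw [update_of_ne (hne k hk).symm, update_comm (hne k hk)])
    (fun k hk s => by simp [hne k hk])
    (fun z hz s => by
      rw [update_of_ne]
      rintro rfl
      exact hτz hz)
  exact ⟨gs, by omega, fun v hv s => by simpa using h2 v hv s⟩

end ZeroTest

/-! ### Colourings -/

/-- At most `r ^ 2` sets of at most `t` elements each admit a colouring with `r * t + 1` colours that
is injective on each of the sets: as long as more than `r * t + 1` elements are present, one of them
lies in at most `r` of the sets, and it can be coloured last. -/
theorem exists_coloring {α κ : Type*} [DecidableEq α] [DecidableEq κ] (F : Finset κ)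
    (T : κ → Finset α) (r t : ℕ) (hF : F.card ≤ r * r) (hT : ∀ i ∈ F, (T i).card ≤ t)
    (W : Finset α) :
    ∃ χ : α → Fin (r * t + 1), ∀ i ∈ F, Set.InjOn χ (T i ∩ W : Finset α) := by
  induction hc : W.card generalizing W with
  | zero =>
    rw [Finset.card_eq_zero] at hc
    subst hc
    exact ⟨fun _ => 0, by simp⟩
  | succ n ih =>
    by_cases hW : W.card ≤ r * t + 1
    · have : Nonempty (W ↪ Fin (r * t + 1)) := by
        rw [Function.Embedding.nonempty_iff_card_le]
        simpa using hW
      obtain ⟨e⟩ := this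
      refine ⟨fun a => if h : a ∈ W then e ⟨a, h⟩ else 0, fun i _ a ha b hb hab => ?_⟩
      have ha' : a ∈ W := (Finset.mem_inter.1 ha).2
      have hb' : b ∈ W := (Finset.mem_inter.1 hb).2
      simpa [ha', hb'] using hab
    · -- Otherwise the incidences would number at least `(r * t + 2) * (r + 1) > r * r * t`.
      have hq : ∃ q ∈ W, (F.filter fun i => q ∈ T i).card ≤ r := by
        by_contra! h
        have h1 : ∑ q ∈ W, (F.filter fun i => q ∈ T i).card ≤ ∑ i ∈ F, (T i).card := by
          refine (Finset.sum_card_bipartiteAbove_eq_sum_card_bipartiteBelow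
            fun q i => q ∈ T i).trans_le ?_
          refine Finset.sum_le_sum fun i _ => Finset.card_le_card fun a ha => ?_
          simpa using (Finset.mem_filter.1 ha).2
        have h2 : ∑ i ∈ F, (T i).card ≤ r * r * t :=
          (Finset.sum_le_card_nsmul F _ t hT).trans (by
            rw [smul_eq_mul]; exact Nat.mul_le_mul_right _ hF)
        have h3 : W.card * (r + 1) ≤ ∑ q ∈ W, (F.filter fun i => q ∈ T i).card := by
          rw [← smul_eq_mul]
          exact Finset.card_nsmul_le_sum W _ _ fun q hq => h q hq
        push Not at hW
        have h4 : (r * t + 2) * (r + 1) ≤ r * r * t :=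
          (Nat.mul_le_mul_right _ hW).trans (h3.trans (h1.trans h2))
        nlinarith
      obtain ⟨q, hqW, hq⟩ := hq
      obtain ⟨χ, hχ⟩ := ih (W.erase q) (by rw [Finset.card_erase_of_mem hqW, hc]; rfl)
      -- The sets that contain `q` use at most `r * t` colours.
      have hcard : (((F.filter fun i => q ∈ T i).biUnion T).image χ).card < r * t + 1 := by
        refine Nat.lt_succ_of_le (Finset.card_image_le.trans ?_)
        refine (Finset.card_biUnion_le_card_mul _ _ t fun i hi => hT i (Finset.mem_filter.1 hi).1)
          |>.trans (Nat.mul_le_mul_right _ hq)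
      obtain ⟨c, -, hc'⟩ := Finset.exists_mem_notMem_of_card_lt_card
        (s := ((F.filter fun i => q ∈ T i).biUnion T).image χ) (t := Finset.univ)
        (by simpa using hcard)
      have hfree : ∀ i ∈ F, q ∈ T i → ∀ b ∈ T i, χ b ≠ c := by
        intro i hi hqi b hb h
        exact hc' (Finset.mem_image.2 ⟨b, Finset.mem_biUnion.2
          ⟨i, Finset.mem_filter.2 ⟨hi, hqi⟩, hb⟩, h⟩)
      refine ⟨update χ q c, fun i hi a ha b hb hab => ?_⟩
      simp only [Finset.coe_inter, Set.mem_inter_iff, Finset.mem_coe] at ha hb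
      by_cases haq : a = q <;> by_cases hbq : b = q
      · rw [haq, hbq]
      · subst haq
        rw [update_self, update_of_ne hbq] at hab
        exact absurd hab.symm (hfree i hi ha.1 b hb.1)
      · subst hbq
        rw [update_self, update_of_ne haq] at hab
        exact absurd hab (hfree i hi hb.1 a ha.1)
      · rw [update_of_ne haq, update_of_ne hbq] at hab
        exact hχ i hi (by simp [ha, haq]) (by simp [hb, hbq]) hab

/-! ### Reflections about prepared states -/

section Reflection

variable {ι : Type} [Fintype ι] [DecidableEq ι]

/-- The basis state of the configuration `s`. -/
def ket (s : ι → Bool) : (ι → Bool) → ℂ := Pi.single s 1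

/-- The configuration in which all qubits are zero. -/
def zeroConf : ι → Bool := fun _ => false

/-- The configuration in which exactly the qubit `q` is one. -/
def hotConf (q : ι) : ι → Bool := update zeroConf q true

omit [DecidableEq ι] in
theorem ket_apply (s t : ι → Bool) : ket s t = if t = s then 1 else 0 := by
  simp [ket, Pi.single_apply]

theorem CleanOn.run {ks : List ι} {v : (ι → Bool) → ℂ} (hv : CleanOn ks v) (gs : List (Gate ι))
    (h : ∀ k ∈ ks, k ∉ wires gs) : CleanOn ks (run gs v) := by
  intro s hs k hk
  obtain ⟨t, ht, hts⟩ := exists_of_run_ne_zero gs hs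
  rw [← hts k (h k hk)]
  exact hv t ht k hk

/-- The reflection about the state `w` that a circuit `Q` on the qubits `R` prepares from the zero
state is `Q (1 - 2|0⟩⟨0|) Q†`. The zero test may be restricted to a set `Z ⊇ R` of qubits, on states
`ξ` in which the qubits outside `R` are all zero as soon as those in `Z` are. -/
theorem exists_reflection (Q : List (Gate ι)) (R : Finset ι) (Z ks : List ι)
    (hlen : Z.length < ks.length) (hnd : ks.Nodup) (hdisj : ∀ z ∈ Z, z ∉ ks)
    (hQ : wires Q ⊆ R) (hR : ∀ q ∈ R, q ∈ Z) :
    ∃ gs : List (Gate ι), gs.length ≤ 2 * Q.length + 14 * Z.length + 3 ∧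
      ∀ ξ, CleanOn ks ξ →
        (∀ t, ξ t ≠ 0 → (∀ q ∈ Z, q ∉ R → t q = false) → ∀ q ∉ R, t q = false) →
        run gs ξ = ξ - (2 * braket (run Q (ket zeroConf)) ξ) • run Q (ket zeroConf) := by
  obtain ⟨P, hPl, hPr⟩ := exists_zero_phase Z ks hlen hnd hdisj
  refine ⟨invCircuit Q ++ P ++ Q, by simp; omega, fun ξ hξ hsupp => ?_⟩
  have hclean : CleanOn ks (run (invCircuit Q) ξ) :=
    hξ.run _ fun k hk hk' => hdisj k (hR k (hQ (by simpa using hk'))) hk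
  set η := run (invCircuit Q) ξ with hη
  have hη0 : η zeroConf = braket (run Q (ket zeroConf)) ξ := by
    rw [braket_run, ← hη, braket, ket, ← Pi.single_star, star_one, single_one_dotProduct]
  have hP : run P η = η - (2 * η zeroConf) • ket zeroConf := by
    ext s
    rw [hPr η hclean s, Pi.sub_apply, Pi.smul_apply, ket_apply, smul_eq_mul]
    by_cases hs0 : s = zeroConf
    · rw [if_pos hs0, if_pos (by simp [hs0, zeroConf]), hs0]
      ring
    · rw [if_neg hs0, mul_zero, sub_zero]
      split_ifs with hZ
      · -- A configuration `s ≠ 0` that passes the test comes from some `t` in the support of `ξ`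
        -- which agrees with `s` outside `R`.
        suffices η s = 0 by rw [this, neg_zero]
        by_contra hne
        obtain ⟨t, ht, hts⟩ := exists_of_run_ne_zero _ hne
        rw [wires_invCircuit] at hts
        have hoff := hsupp t ht fun q hqZ hqR => by
          rw [hts q fun h => hqR (hQ h)]
          exact hZ q hqZ
        refine hs0 (funext fun q => ?_)
        by_cases hqR : q ∈ R
        · exact hZ q (hR q hqR)
        · rw [← hts q fun h => hqR (hQ h)]
          exact hoff q hqR
      · rfl
  rw [run_append, run_append, ← hη, hP, run_sub, run_smul, hη0, hη, run_run_invCircuit]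

/-! ### Preparation of superpositions -/

theorem toMatrix_two_mulVec_ket (a b : ι) (h : a ≠ b) (u : Matrix.unitaryGroup (Bool × Bool) ℂ)
    (t : ι → Bool) : (Gate.two a b h u).toMatrix *ᵥ ket t =
      ∑ y : Bool × Bool, u.1 y (t a, t b) • ket (update (update t a y.1) b y.2) := by
  ext s
  rw [toMatrix_two_mulVec, Finset.sum_apply]
  simp only [ket_apply, Pi.smul_apply, smul_eq_mul, mul_ite, mul_one, mul_zero]
  by_cases hst : ∀ q, q ≠ a → q ≠ b → s q = t q
  · rw [Finset.sum_eq_single (t a, t b), Finset.sum_eq_single (s a, s b)]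
    · rw [if_pos, if_pos]
      · ext q
        by_cases hq : q = b
        · subst hq; simp
        · by_cases hq' : q = a
          · subst hq'; simp [hq]
          · simp [hq, hq', hst q hq' hq]
      · ext q
        by_cases hq : q = b
        · subst hq; simp
        · by_cases hq' : q = a
          · subst hq'; simp [hq]
          · simp [hq, hq', hst q hq' hq]
    · intro y _ hy
      rw [if_neg]
      intro e
      apply hy
      have h1 := congrFun e a
      have h2 := congrFun e b
      simp [h] at h1 h2
      exact Prod.ext h1.symm h2.symm
    · simp
    · intro y _ hy
      rw [if_neg]
      intro e
      apply hy
      have h1 := congrFun e a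
      have h2 := congrFun e b
      simp [h] at h1 h2
      exact Prod.ext h1 h2
    · simp
  · rw [Finset.sum_eq_zero, Finset.sum_eq_zero]
    · intro y _
      rw [if_neg]
      rintro rfl
      exact hst fun q hq hq' => by simp [hq, hq']
    · intro y _
      rw [if_neg]
      intro e
      refine hst fun q hq hq' => ?_
      have := congrFun e q
      simpa [hq, hq'] using this

/-- A rotation in the plane of the two basis states with exactly one of the qubits `p`, `q` equal to one. -/
theorem exists_rotation (p q : ι) (hpq : p ≠ q) (c s : ℝ) (hcs : c ^ 2 + s ^ 2 = 1) :
    ∃ g : Gate ι, g.wires = {p, q} ∧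
      g.toMatrix *ᵥ ket (hotConf p) = (c : ℂ) • ket (hotConf p) + (s : ℂ) • ket (hotConf q) ∧
      ∀ r, r ≠ p → r ≠ q → g.toMatrix *ᵥ ket (hotConf r) = ket (hotConf r) := by
  let U : Matrix (Bool × Bool) (Bool × Bool) ℂ := Matrix.of fun x y =>
    match x, y with
    | (false, false), (false, false) => 1
    | (true, true), (true, true) => 1
    | (true, false), (true, false) => c
    | (false, true), (true, false) => s
    | (true, false), (false, true) => -s
    | (false, true), (false, true) => c
    | _, _ => 0
  have hcs' : (c : ℂ) * c + s * s = 1 := by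
    have : c * c + s * s = 1 := by linarith [hcs, sq c, sq s]
    exact_mod_cast this
  have hU : U ∈ Matrix.unitaryGroup (Bool × Bool) ℂ := by
    rw [Matrix.mem_unitaryGroup_iff]
    ext ⟨x, y⟩ ⟨x', y'⟩
    rw [Matrix.mul_apply]
    simp only [Fintype.sum_prod_type, Fintype.sum_bool, Matrix.star_apply, U, Matrix.of_apply,
      Matrix.one_apply, Prod.mk.injEq]
    cases x <;> cases x' <;> cases y <;> cases y' <;> simp <;>
      first | linear_combination hcs' | ring
  refine ⟨.two p q hpq ⟨U, hU⟩, rfl, ?_, ?_⟩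
  · rw [toMatrix_two_mulVec_ket]
    have e1 : update (update (hotConf p) p true) q false = hotConf p := by
      ext r
      by_cases hr : r = q
      · subst hr; simp [hotConf, zeroConf, hpq.symm]
      · simp [hr, hotConf]
    have e2 : update (update (hotConf p) p false) q true = hotConf q := by
      ext r
      by_cases hr : r = q
      · subst hr; simp [hotConf]
      · by_cases hr' : r = p <;> simp [hr, hr', hotConf, zeroConf, hpq]
    have h1 : hotConf p p = true := by simp [hotConf]
    have h2 : hotConf p q = false := by simp [hotConf, hpq.symm, zeroConf]
    simp [Fintype.sum_prod_type, h1, h2, U, e1, e2]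
  · intro r hrp hrq
    rw [toMatrix_two_mulVec_ket]
    have h1 : hotConf r p = false := by simp [hotConf, hrp.symm, zeroConf]
    have h2 : hotConf r q = false := by simp [hotConf, hrq.symm, zeroConf]
    have e : update (update (hotConf r) p false) q false = hotConf r := by
      rw [← h1, update_eq_self, h1, ← h2, update_eq_self]
    simp [Fintype.sum_prod_type, h1, h2, U, e]

/-- The amplitudes are split off the basis state `|p⟩` one at a time. No normalization is assumed, so that
the statement is suited to induction. -/
theorem exists_hot_superposition (p : ι) (T : Finset ι) (hp : p ∉ T) (β : ℝ) (hβ : 0 < β)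
    (α : ι → ℝ) :
    ∃ gs : List (Gate ι), gs.length ≤ T.card ∧ wires gs ⊆ insert p T ∧
      (∀ r, r ∉ insert p T → run gs (ket (hotConf r)) = ket (hotConf r)) ∧
      run gs ((√(β ^ 2 + ∑ q ∈ T, α q ^ 2) : ℂ) • ket (hotConf p)) =
        (β : ℂ) • ket (hotConf p) + ∑ q ∈ T, (α q : ℂ) • ket (hotConf q) := by
  induction T using Finset.induction_on with
  | empty => exact ⟨[], by simp, by simp, by simp, by simp [Real.sqrt_sq hβ.le]⟩
  | insert q T hq ih =>
    have hpT : p ∉ T := fun h => hp (Finset.mem_insert_of_mem h)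
    have hpq : p ≠ q := by rintro rfl; simp at hp
    obtain ⟨gs, hl, hw, hfix, hrun⟩ := ih hpT
    set x := β ^ 2 + ∑ q ∈ T, α q ^ 2 with hx
    have hx0 : 0 < x := by
      have : 0 ≤ ∑ q ∈ T, α q ^ 2 := Finset.sum_nonneg fun _ _ => sq_nonneg _
      positivity
    have hy : β ^ 2 + ∑ r ∈ insert q T, α r ^ 2 = x + α q ^ 2 := by
      rw [Finset.sum_insert hq, hx]; ring
    have hy0 : 0 < x + α q ^ 2 := by positivity
    have hsy : √(x + α q ^ 2) ≠ 0 := (Real.sqrt_pos.2 hy0).ne'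
    obtain ⟨g, hgw, hg, hgfix⟩ := exists_rotation p q hpq (√x / √(x + α q ^ 2))
      (α q / √(x + α q ^ 2)) (by
        rw [div_pow, div_pow, Real.sq_sqrt hx0.le, Real.sq_sqrt hy0.le]
        field_simp)
    refine ⟨g :: gs, by simp [Finset.card_insert_of_notMem hq, hl], ?_, ?_, ?_⟩
    · rw [wires_cons, hgw]
      intro r hr
      have := @hw r
      simp at hr this ⊢
      tauto
    · intro r hr
      simp only [Finset.mem_insert, not_or] at hr
      rw [run_cons, hgfix r hr.1 hr.2.1, hfix r (by simp [hr])]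
    · have hsy' : ((√(x + α q ^ 2) : ℝ) : ℂ) ≠ 0 := by exact_mod_cast hsy
      rw [hy, run_smul, run_cons, hg, ← run_smul, smul_add, smul_smul, smul_smul]
      push_cast
      rw [mul_div_cancel₀ _ hsy', mul_div_cancel₀ _ hsy', run_add, hrun, run_smul,
        hfix q (by simp [hpq.symm, hq]), Finset.sum_insert hq]
      abel

/-- Circuits controlled by distinct qubits are applied independently on configurations in which
exactly one of the control qubits is one. -/
theorem exists_multiplexed_circuit (H : Finset ι) (D : ι → List (Gate ι))
    (hD : ∀ q ∈ H, ∀ r ∈ H, r ∉ wires (D q)) (T : Finset ι) (hT : T ⊆ H) :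
    ∃ gs : List (Gate ι), gs.length ≤ 7 * ∑ q ∈ T, (D q).length ∧
      wires gs ⊆ T ∪ T.biUnion (fun q => wires (D q)) ∧
      ∀ q ∈ H, ∀ v, (∀ s, v s ≠ 0 → ∀ r ∈ H, s r = decide (r = q)) →
        run gs v = if q ∈ T then run (D q) v else v := by
  induction T using Finset.induction_on with
  | empty => exact ⟨[], by simp, by simp, by simp⟩
  | insert p T hp ih =>
    have hpH : p ∈ H := hT (Finset.mem_insert_self _ _)
    obtain ⟨gs, hl, hw, hrun⟩ := ih ((Finset.subset_insert _ _).trans hT)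
    obtain ⟨hs, hl', hw', hrun'⟩ := exists_ctrl_circuit p (D p) (hD p hpH p hpH)
    refine ⟨gs ++ hs, ?_, ?_, ?_⟩
    · rw [Finset.sum_insert hp, List.length_append]; omega
    · rw [wires_append]
      intro r hr
      have := @hw r
      have := @hw' r
      simp only [Finset.mem_union, Finset.mem_insert, Finset.mem_biUnion, exists_eq_or_imp] at *
      tauto
    · intro q hq v hv
      rw [run_append, hrun q hq v hv]
      have key : ∀ v' : (ι → Bool) → ℂ, (∀ s, v' s ≠ 0 → ∀ r ∈ H, s r = decide (r = q)) →
          run hs v' = if p = q then run (D p) v' else v' := by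
        intro v' hv'
        ext s
        rw [hrun']
        by_cases hpq : p = q
        · subst hpq
          rw [if_pos rfl]
          split_ifs with hsp
          · rfl
          · have h1 : v' s = 0 := by
              by_contra h
              have := hv' s h p hpH
              simp at this
              exact hsp this
            have h2 : run (D p) v' s = 0 := by
              by_contra h
              obtain ⟨t, ht, hts⟩ := exists_of_run_ne_zero _ h
              have := hv' t ht p hpH
              rw [hts p (hD p hpH p hpH)] at this
              simp at this
              exact hsp this
            rw [h1, h2]
        · rw [if_neg hpq]
          split_ifs with hsp
          · have h1 : v' s = 0 := by
              by_contra h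
              have := hv' s h p hpH
              simp [hsp, hpq] at this
            have h2 : run (D p) v' s = 0 := by
              by_contra h
              obtain ⟨t, ht, hts⟩ := exists_of_run_ne_zero _ h
              have := hv' t ht p hpH
              rw [hts p (hD p hpH p hpH)] at this
              simp [hsp, hpq] at this
            rw [h1, h2]
          · rfl
      by_cases hqT : q ∈ T
      · have hpq : p ≠ q := by rintro rfl; exact hp hqT
        rw [if_pos hqT, if_pos (Finset.mem_insert_of_mem hqT), key, if_neg hpq]
        intro s hs r hr
        obtain ⟨t, ht, hts⟩ := exists_of_run_ne_zero _ hs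
        rw [← hts r (hD q hq r hr)]
        exact hv t ht r hr
      · rw [if_neg hqT, key v hv]
        by_cases hpq : p = q
        · subst hpq; simp
        · rw [if_neg hpq, if_neg]
          simp [hqT, Ne.symm hpq]

/-- A superposition of states `D q |q⟩`, where `|q⟩` is the basis state in which exactly the qubit
`q` is one, is prepared by loading the amplitudes onto the basis states `|q⟩` and applying the
circuits `D q` under the control of `q`. -/
theorem exists_superposition (p : ι) (T : Finset ι) (hp : p ∉ T) (β : ℝ) (hβ : 0 < β)
    (α : ι → ℝ) (hnorm : β ^ 2 + ∑ q ∈ T, α q ^ 2 = 1) (D : ι → List (Gate ι))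
    (hD : ∀ q ∈ insert p T, ∀ r ∈ insert p T, r ∉ wires (D q)) :
    ∃ Q : List (Gate ι), Q.length ≤ T.card + 1 + 7 * ∑ q ∈ insert p T, (D q).length ∧
      wires Q ⊆ insert p T ∪ (insert p T).biUnion (fun q => wires (D q)) ∧
      run Q (ket zeroConf) = (β : ℂ) • run (D p) (ket (hotConf p)) +
        ∑ q ∈ T, (α q : ℂ) • run (D q) (ket (hotConf q)) := by
  obtain ⟨gs, hl, hw, -, hrun⟩ := exists_hot_superposition p T hp β hβ α
  obtain ⟨hs, hl', hw', hrun'⟩ := exists_multiplexed_circuit (insert p T) D hD _ subset_rfl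
  have hX : run [notGate p] (ket zeroConf) = ket (hotConf p) := by
    ext s
    rw [run_singleton, notGate_mulVec, ket_apply, ket_apply]
    refine if_congr ?_ rfl rfl
    constructor
    · intro h
      ext q
      have h' := congrFun h q
      by_cases hq : q = p
      · subst hq; simpa [hotConf, zeroConf] using h'
      · simpa [hotConf, hq] using h'
    · rintro rfl
      simp [hotConf, zeroConf]
  have hhot : ∀ q ∈ insert p T, run hs (ket (hotConf q)) = run (D q) (ket (hotConf q)) := by
    intro q hq
    rw [hrun' q hq, if_pos hq]
    intro s hs r hr
    have : s = hotConf q := by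
      by_contra h
      exact hs (by simp [ket_apply, h])
    subst this
    by_cases h : r = q <;> simp [hotConf, zeroConf, h]
  refine ⟨notGate p :: (gs ++ hs), ?_, ?_, ?_⟩
  · simp only [List.length_cons, List.length_append]; omega
  · rw [wires_cons, wires_append]
    intro r hr
    have := @hw r
    have := @hw' r
    have hn : (notGate p).wires = {p} := rfl
    simp only [Finset.mem_union, hn, Finset.mem_singleton, Finset.mem_insert] at *
    tauto
  · rw [hnorm, Real.sqrt_one, Complex.ofReal_one, one_smul] at hrun
    rw [run_cons' , hX, run_append, hrun, run_add, run_smul, run_sum, hhot p (by simp)]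
    congr 1
    refine Finset.sum_congr rfl fun q hq => ?_
    rw [run_smul, hhot q (by simp [hq])]

end Reflection

/-! ### Inner products -/

section Braket

variable {κ : Type*} [Fintype κ]

theorem braket_sub_right (u v w : κ → ℂ) : braket u (v - w) = braket u v - braket u w :=
  dotProduct_sub _ _ _

theorem braket_smul_right (c : ℂ) (u v : κ → ℂ) : braket u (c • v) = c * braket u v :=
  dotProduct_smul _ _ _

theorem braket_sum_right {J : Type*} (T : Finset J) (u : κ → ℂ) (v : J → κ → ℂ) :
    braket u (∑ j ∈ T, v j) = ∑ j ∈ T, braket u (v j) :=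
  dotProduct_sum _ _ _

theorem star_braket (u v : κ → ℂ) : star (braket u v) = braket v u := by
  rw [braket, braket, star_dotProduct, star_star]

theorem braket_sub_left (u v w : κ → ℂ) : braket (u - v) w = braket u w - braket v w := by
  rw [← star_braket, braket_sub_right, star_sub, star_braket, star_braket]

theorem braket_real_smul_left (c : ℝ) (u v : κ → ℂ) :
    braket ((c : ℂ) • u) v = c * braket u v := by
  rw [← star_braket, braket_smul_right, star_mul', star_braket]
  simp

theorem braket_sum_left {J : Type*} (T : Finset J) (u : J → κ → ℂ) (v : κ → ℂ) :
    braket (∑ j ∈ T, u j) v = ∑ j ∈ T, braket (u j) v := by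
  rw [← star_braket, braket_sum_right, star_sum]
  simp only [star_braket]

theorem braket_comp_involutive {f : κ → κ} (hf : Involutive f) (u v : κ → ℂ) :
    braket u (v ∘ f) = braket (u ∘ f) v := by
  have := (Equiv.sum_comp hf.toPerm fun s => star (u (f s)) * v s)
  simp only [braket, dotProduct, Pi.star_apply, Function.comp_apply]
  rw [← this]
  exact Finset.sum_congr rfl fun s _ => by simp [hf s]

theorem braket_eq_zero_of_disjoint {u v : κ → ℂ} (h : ∀ s, u s ≠ 0 → v s ≠ 0 → False) :
    braket u v = 0 := by
  refine Finset.sum_eq_zero fun s _ => ?_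
  by_cases hu : u s = 0
  · simp [hu]
  · by_cases hv : v s = 0
    · simp [hv]
    · exact (h s hu hv).elim

theorem braket_ket {ι : Type} [Fintype ι] [DecidableEq ι] (s : ι → Bool) (v : (ι → Bool) → ℂ) :
    braket (ket s) v = v s := by
  rw [braket, ket, ← Pi.single_star, star_one, single_one_dotProduct]

end Braket

/-! ### States that are basis states outside some of the qubits -/

section Lift

variable {ι κ : Type} [Fintype ι] [DecidableEq ι] [Fintype κ] [DecidableEq κ]

omit [DecidableEq κ] in
theorem lift_ne_zero {f : κ → ι} {c : ι → Bool} {v : (κ → Bool) → ℂ} {s : ι → Bool}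
    (h : lift f c v s ≠ 0) : (∀ q ∉ Set.range f, s q = c q) ∧ v (s ∘ f) ≠ 0 := by
  unfold lift at h
  split_ifs at h with hc
  · exact ⟨hc, h⟩
  · exact absurd rfl h

omit [DecidableEq κ] in
theorem ket_eq_lift {f : κ → ι} (c : ι → Bool) : ket c = lift f c (ket (c ∘ f)) := by
  classical
  ext s
  unfold lift
  rw [ket_apply, ket_apply]
  by_cases h : s = c
  · simp [h]
  · rw [if_neg h]
    split_ifs with h1 h2
    · refine absurd (funext fun q => ?_) h
      by_cases hq : q ∈ Set.range f
      · obtain ⟨k, rfl⟩ := hq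
        exact congrFun h2 k
      · exact h1 q hq
    · rfl
    · rfl

theorem braket_lift {f : κ → ι} (hf : Injective f) (c : ι → Bool) (v w : (κ → Bool) → ℂ) :
    braket (lift f c v) (lift f c w) = braket v w := by
  classical
  unfold braket dotProduct
  symm
  let e : (κ → Bool) → (ι → Bool) := fun b q =>
    if h : ∃ k, f k = q then b h.choose else c q
  have he1 : ∀ b k, e b (f k) = b k := by
    intro b k
    have h : ∃ k', f k' = f k := ⟨k, rfl⟩
    simp only [e, h, dite_true]
    rw [hf h.choose_spec]
  have he2 : ∀ b, ∀ q ∉ Set.range f, e b q = c q := by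
    intro b q hq
    simp only [e]
    rw [dif_neg]
    exact hq
  apply Fintype.sum_of_injective e
  · intro b b' h
    ext k
    rw [← he1 b, h, he1]
  · intro s hs
    by_contra hne
    have h := lift_ne_zero (right_ne_zero_of_mul hne)
    refine hs ⟨s ∘ f, funext fun q => ?_⟩
    by_cases hq : q ∈ Set.range f
    · obtain ⟨k, rfl⟩ := hq
      rw [he1]; rfl
    · rw [he2 _ q hq, h.1 q hq]
  · intro b
    have hb : e b ∘ f = b := funext fun k => he1 b k
    simp only [Pi.star_apply, lift]
    rw [if_pos (he2 b), if_pos (he2 b), hb]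

omit [DecidableEq κ] in
theorem braket_lift_of_ne {f : κ → ι} {c c' : ι → Bool} {q : ι} (hq : q ∉ Set.range f)
    (h : c q ≠ c' q) (v w : (κ → Bool) → ℂ) : braket (lift f c v) (lift f c' w) = 0 := by
  refine braket_eq_zero_of_disjoint fun s hs hs' => h ?_
  rw [← (lift_ne_zero hs).1 q hq, ← (lift_ne_zero hs').1 q hq]

end Lift

/-! ### The work qubits -/

/-- The work qubits: a flag, which marks the inputs not yet treated; a qubit `out y` for each
possible value `y` of the system register; the `m` qubits of the ancilla; `l` qubits for the parities
of colour classes of ancilla qubits; and `L` qubits in which conjunctions are computed. -/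
inductive Work (N m l L : ℕ) : Type
  | flag : Work N m l L
  | out (y : Fin N) : Work N m l L
  | anc (q : Fin m) : Work N m l L
  | hash (c : Fin l) : Work N m l L
  | chain (i : Fin L) : Work N m l L
deriving DecidableEq, Fintype

section Wires

variable {N m l L : ℕ} {n : ℕ}

/-- System register of `n` qubits together with the work qubits. -/
abbrev Wire (n N m l L : ℕ) : Type := Fin n ⊕ Work N m l L

/-- The inclusion of the ancilla into all qubits. -/
def ancWire (n N l L : ℕ) {m : ℕ} (q : Fin m) : Wire n N m l L := Sum.inr (Work.anc q)

theorem ancWire_injective : Injective (ancWire n N l L : Fin m → Wire n N m l L) := by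
  intro a b h
  simpa [ancWire] using h

/-- The configuration with the given contents of the system register, the flag, and the ancilla, in
which the qubits `out y` are given by `o`, and all other qubits are zero. -/
def conf (l L : ℕ) (a : Fin n → Bool) (f : Bool) (o : Fin N → Bool) (b : Fin m → Bool) :
    Wire n N m l L → Bool :=
  Sum.elim a fun
    | .flag => f
    | .out y => o y
    | .anc q => b q
    | .hash _ => false
    | .chain _ => false

/-- The configuration of the qubits `out y` in which just the one with index `y` is one. -/
def hot (y : Fin N) : Fin N → Bool := fun z => decide (z = y)

theorem eq_conf_of_lift_ne_zero {a : Fin n → Bool} {f : Bool} {o : Fin N → Bool}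
    {b : Fin m → Bool} {v : (Fin m → Bool) → ℂ} {s : Wire n N m l L → Bool}
    (h : lift (ancWire n N l L) (conf l L a f o b) v s ≠ 0) :
    s = conf l L a f o (s ∘ ancWire n N l L) ∧ v (s ∘ ancWire n N l L) ≠ 0 := by
  obtain ⟨h1, h2⟩ := lift_ne_zero h
  refine ⟨funext fun q => ?_, h2⟩
  by_cases hq : q ∈ Set.range (ancWire n N l L : Fin m → Wire n N m l L)
  · obtain ⟨k, rfl⟩ := hq
    rfl
  · rw [h1 q hq]
    rcases q with i | (_ | y | k | c | i) <;> first | rfl | exact (hq ⟨k, rfl⟩).elim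

/-! ### Parities of colour classes -/

/-- The reversible map that adds to each qubit `hash c` the parity of the ancilla qubits in `D` of
colour `c`. -/
def hashMap (χ : Fin m → Fin l) (D : Finset (Fin m)) (s : Wire n N m l L → Bool) :
    Wire n N m l L → Bool
  | .inr (.hash c) => xor (s (.inr (.hash c)))
      (decide (Odd (D.filter fun q => χ q = c ∧ s (.inr (.anc q)) = true).card))
  | w => s w

theorem hashMap_hash (χ : Fin m → Fin l) (D : Finset (Fin m)) (s : Wire n N m l L → Bool)
    (c : Fin l) : hashMap χ D s (.inr (.hash c)) = xor (s (.inr (.hash c)))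
      (decide (Odd (D.filter fun q => χ q = c ∧ s (.inr (.anc q)) = true).card)) := rfl

@[simp] theorem hashMap_anc (χ : Fin m → Fin l) (D : Finset (Fin m)) (s : Wire n N m l L → Bool)
    (q : Fin m) : hashMap χ D s (.inr (.anc q)) = s (.inr (.anc q)) := rfl

theorem hashMap_of_ne (χ : Fin m → Fin l) (D : Finset (Fin m)) (s : Wire n N m l L → Bool)
    (w : Wire n N m l L) (hw : ∀ c, w ≠ .inr (.hash c)) : hashMap χ D s w = s w := by
  rcases w with i | (_ | y | k | c | i) <;> first | rfl | exact (hw c rfl).elim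

theorem odd_card_filter_symmDiff {α : Type*} [DecidableEq α] (D D' : Finset α) (p : α → Prop)
    [DecidablePred p] :
    decide (Odd ((symmDiff D D').filter p).card) =
      xor (decide (Odd (D.filter p).card)) (decide (Odd (D'.filter p).card)) := by
  have h1 : ((symmDiff D D').filter p).card + 2 * ((D ∩ D').filter p).card =
      (D.filter p).card + (D'.filter p).card := by
    have e1 : (D.filter p).card = ((D \ D').filter p).card + ((D ∩ D').filter p).card := by
      rw [← Finset.card_union_of_disjoint, ← Finset.filter_union, Finset.sdiff_union_inter]
      exact Finset.disjoint_filter_filter (Finset.disjoint_sdiff_inter D D')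
    have e2 : (D'.filter p).card = ((D' \ D).filter p).card + ((D ∩ D').filter p).card := by
      rw [Finset.inter_comm, ← Finset.card_union_of_disjoint, ← Finset.filter_union,
        Finset.sdiff_union_inter]
      exact Finset.disjoint_filter_filter (Finset.disjoint_sdiff_inter D' D)
    have e3 : ((symmDiff D D').filter p).card =
        ((D \ D').filter p).card + ((D' \ D).filter p).card := by
      rw [← Finset.card_union_of_disjoint, ← Finset.filter_union]
      · rfl
      · exact Finset.disjoint_filter_filter disjoint_sdiff_sdiff
    omega
  rw [Bool.eq_iff_iff]
  simp only [decide_eq_true_eq, bne_iff_ne, ne_eq, decide_eq_decide, Nat.odd_iff]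
  omega

theorem hashMap_hashMap (χ : Fin m → Fin l) (D D' : Finset (Fin m))
    (s : Wire n N m l L → Bool) :
    hashMap χ D (hashMap χ D' s) = hashMap χ (symmDiff D D') s := by
  ext w
  rcases w with i | (_ | y | k | c | i) <;> try rfl
  rw [hashMap_hash, hashMap_hash, hashMap_hash]
  simp only [hashMap_anc]
  rw [odd_card_filter_symmDiff, Bool.xor_assoc, Bool.xor_comm (decide _) (decide _)]
  congr!

theorem hashMap_eq_self (χ : Fin m → Fin l) (D : Finset (Fin m)) (s : Wire n N m l L → Bool)
    (h : ∀ q ∈ D, s (.inr (.anc q)) = false) : hashMap χ D s = s := by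
  ext w
  rcases w with i | (_ | y | k | c | i) <;> try rfl
  rw [hashMap_hash, Finset.filter_eq_empty_iff.2]
  · simp
  · intro q hq hq'
    simp [h q hq] at hq'

theorem hashMap_involutive (χ : Fin m → Fin l) (D : Finset (Fin m)) :
    Involutive (hashMap χ D : (Wire n N m l L → Bool) → _) := by
  intro s
  rw [hashMap_hashMap, symmDiff_self]
  exact hashMap_eq_self _ _ _ (by simp)

theorem exists_hash_circuit (χ : Fin m → Fin l) (D : Finset (Fin m)) :
    ∃ gs : List (Gate (Wire n N m l L)), gs.length ≤ D.card ∧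
      ∀ v, run gs v = v ∘ hashMap χ D := by
  induction D using Finset.induction_on with
  | empty =>
    refine ⟨[], by simp, fun v => ?_⟩
    ext s
    rw [run_nil, Function.comp_apply, hashMap_eq_self _ _ _ (by simp)]
  | insert q D hq ih =>
    obtain ⟨gs, hl, hr⟩ := ih
    refine ⟨xorGate id (.inr (.anc q)) (.inr (.hash (χ q))) (by simp) :: gs,
      by simp [Finset.card_insert_of_notMem hq, hl], fun v => ?_⟩
    ext s
    rw [run_cons, hr, Function.comp_apply, xorGate_mulVec, Function.comp_apply]
    congr 1
    have hD : insert q D = symmDiff {q} D := by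
      ext r
      by_cases hrq : r = q
      · subst hrq; simp [Finset.mem_symmDiff, hq]
      · simp [Finset.mem_symmDiff, hrq]
    rw [hD, ← hashMap_hashMap]
    ext w
    by_cases hw : w = .inr (.hash (χ q))
    · subst hw
      rw [update_self, hashMap_hash _ {q}, Bool.xor_comm]
      congr 1
      rw [Finset.filter_singleton]
      cases h : s (.inr (.anc q)) <;> simp [h]
    · rw [update_of_ne hw]
      rcases w with i | (_ | y | k | c | i) <;> try rfl
      have hc : χ q ≠ c := fun h => hw (by rw [h])
      rw [hashMap_hash _ {q}, Finset.filter_singleton]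
      simp [hc]

theorem comp_hashMap_eq_self (χ : Fin m → Fin l) (D : Finset (Fin m))
    (w : (Wire n N m l L → Bool) → ℂ)
    (hw : ∀ s, w s ≠ 0 → ∀ q ∈ D, s (.inr (.anc q)) = false) : w ∘ hashMap χ D = w := by
  ext s
  rw [Function.comp_apply]
  by_cases h : ∀ q ∈ D, s (.inr (.anc q)) = false
  · rw [hashMap_eq_self _ _ _ h]
  · rw [not_imp_comm.1 (hw s) h, not_imp_comm.1 (hw _) (by simpa using h)]

/-! ### Adding a constant to the system register -/

/-- Addition of the bit string `a` to the system register. -/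
def xorSys (a : Fin n → Bool) (s : Wire n N m l L → Bool) : Wire n N m l L → Bool :=
  Sum.elim (fun i => xor (s (.inl i)) (a i)) (fun w => s (.inr w))

theorem exists_xorSys_circuit (a : Fin n → Bool) :
    ∃ gs : List (Gate (Wire n N m l L)), gs.length ≤ n ∧
      wires gs ⊆ Finset.univ.image Sum.inl ∧ ∀ v, run gs v = v ∘ xorSys a := by
  have key : ∀ D : Finset (Fin n), ∃ gs : List (Gate (Wire n N m l L)), gs.length ≤ D.card ∧
      wires gs ⊆ Finset.univ.image Sum.inl ∧
      ∀ v, run gs v = v ∘ xorSys fun i => decide (i ∈ D) := by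
    intro D
    induction D using Finset.induction_on with
    | empty =>
      refine ⟨[], by simp, by simp, fun v => ?_⟩
      ext s
      rw [run_nil, Function.comp_apply]
      congr 1
      ext w
      cases w <;> simp [xorSys]
    | insert j D hj ih =>
      obtain ⟨gs, hl, hw, hr⟩ := ih
      refine ⟨notGate (.inl j) :: gs, by simp [Finset.card_insert_of_notMem hj, hl], ?_,
        fun v => ?_⟩
      · rw [wires_cons]
        refine Finset.union_subset ?_ hw
        simp [notGate, Gate.wires]
      · ext s
        rw [run_cons, hr, Function.comp_apply, notGate_mulVec, Function.comp_apply]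
        congr 1
        ext w
        rcases w with i | w
        · by_cases hi : i = j
          · subst hi; simp [xorSys, hj]
          · rw [update_of_ne (by simpa using hi)]
            simp [xorSys, hi]
        · simp [xorSys]
  obtain ⟨gs, hl, hw, hr⟩ := key (Finset.univ.filter fun i => a i = true)
  refine ⟨gs, hl.trans ((Finset.card_le_univ _).trans (by simp)), hw, fun v => ?_⟩
  simpa using hr v

theorem lift_comp_xorSys (a a' : Fin n → Bool) (f : Bool) (o : Fin N → Bool) (b : Fin m → Bool)
    (v : (Fin m → Bool) → ℂ) :
    lift (ancWire n N l L) (conf l L a' f o b) v ∘ xorSys a =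
      lift (ancWire n N l L) (conf l L (fun i => xor (a' i) (a i)) f o b) v := by
  ext s
  rw [Function.comp_apply]
  unfold lift
  refine if_congr (forall₂_congr fun q hq => ?_) rfl rfl
  rcases q with i | w
  · change xor (s (.inl i)) (a i) = a' i ↔ s (.inl i) = xor (a' i) (a i)
    cases s (.inl i) <;> cases a i <;> cases a' i <;> simp
  · rfl

end Wires

/-! ### The isometry on one cycle -/

section Cycle

variable {N m n : ℕ} (l L : ℕ) (enc : Fin N → Fin n → Bool) (A : Finset (Fin N))
  (κ : Fin N → Fin N → ℝ) (P : Fin N → Fin N → List (Gate (Fin m)))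

/-- The input `x`: the system register contains `x`, and the flag is one. -/
noncomputable def inState (x : Fin N) : (Wire n N m l L → Bool) → ℂ :=
  lift (ancWire n N l L) (conf l L (enc x) true (fun _ => false) fun _ => false) (ket zeroConf)

/-- The system register contains `y`, the qubit `out y` is one, and the ancilla is in the
state `v`. -/
noncomputable def branch (y : Fin N) (v : (Fin m → Bool) → ℂ) : (Wire n N m l L → Bool) → ℂ :=
  lift (ancWire n N l L) (conf l L (enc y) false (hot y) fun _ => false) v

/-- The image of the input `x`: a superposition over the elements `y` of the cycle, with amplitudes
`κ x y`, and with the ancilla in the state prepared by `P x y`. -/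
noncomputable def outState (x : Fin N) : (Wire n N m l L → Bool) → ℂ :=
  ∑ y ∈ A, (κ x y : ℂ) • branch l L enc y (run (P x y) (ket zeroConf))

/-- The unit vector whose reflection exchanges `inState x` and `outState x`. -/
noncomputable def mirror (x : Fin N) : (Wire n N m l L → Bool) → ℂ :=
  (((√2)⁻¹ : ℝ) : ℂ) • (inState l L enc x - outState l L enc A κ P x)

/-- The ancilla qubits that occur in the image of the input `x`. -/
def touched (x : Fin N) : Finset (Fin m) := A.biUnion fun y => wires (P x y)

/-- The ancilla qubits that occur in the images of the inputs in `A`. -/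
def allTouched : Finset (Fin m) := A.biUnion (touched A P)

/-- The qubits on which `mirror x` is prepared. -/
def mirrorWires (n l L : ℕ) (x : Fin N) : Finset (Wire n N m l L) :=
  Finset.univ.image Sum.inl ∪ {Sum.inr Work.flag} ∪ A.image (fun y => Sum.inr (Work.out y)) ∪
    (touched A P x).image (ancWire n N l L)

/-- The amplitudes are such that the states `outState x` with `x ∈ A` are orthonormal. -/
def OrthonormalOn : Prop :=
  ∀ x ∈ A, ∀ x' ∈ A, ∑ y ∈ A, (κ x y : ℂ) * κ x' y *
    braket (run (P x y) (ket zeroConf)) (run (P x' y) (ket zeroConf)) = if x = x' then 1 else 0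

variable {l L enc A κ P}

theorem braket_inState (henc : Injective enc) (x x' : Fin N) :
    braket (inState (m := m) l L enc x) (inState l L enc x') = if x = x' then 1 else 0 := by
  split_ifs with h
  · subst h
    rw [inState, braket_lift ancWire_injective, braket_ket, ket_apply, if_pos rfl]
  · obtain ⟨i, hi⟩ := Function.ne_iff.1 (henc.ne h)
    exact braket_lift_of_ne (q := .inl i) (by rintro ⟨k, hk⟩; simp [ancWire] at hk) hi _ _

theorem braket_inState_branch (x y : Fin N) (v : (Fin m → Bool) → ℂ) :
    braket (inState l L enc x) (branch l L enc y v) = 0 :=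
  braket_lift_of_ne (q := .inr .flag) (by rintro ⟨k, hk⟩; simp [ancWire] at hk)
    (by simp [conf]) _ _

theorem braket_branch (y y' : Fin N) (v v' : (Fin m → Bool) → ℂ) :
    braket (branch l L enc y v) (branch l L enc y' v') = if y = y' then braket v v' else 0 := by
  split_ifs with h
  · subst h
    exact braket_lift ancWire_injective _ _ _
  · exact braket_lift_of_ne (q := .inr (.out y)) (by rintro ⟨k, hk⟩; simp [ancWire] at hk)
      (by simp [conf, hot, h]) _ _

theorem braket_inState_outState (x x' : Fin N) :
    braket (inState l L enc x) (outState l L enc A κ P x') = 0 := by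
  rw [outState, braket_sum_right]
  exact Finset.sum_eq_zero fun y _ => by rw [braket_smul_right, braket_inState_branch, mul_zero]

theorem braket_outState (horth : OrthonormalOn A κ P) {x x' : Fin N} (hx : x ∈ A) (hx' : x' ∈ A) :
    braket (outState l L enc A κ P x) (outState l L enc A κ P x') = if x = x' then 1 else 0 := by
  rw [← horth x hx x' hx', outState, braket_sum_left]
  refine Finset.sum_congr rfl fun y hy => ?_
  rw [braket_real_smul_left, outState, braket_sum_right, Finset.sum_eq_single y]
  · rw [braket_smul_right, braket_branch, if_pos rfl, mul_assoc]
  · intro y' _ hne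
    rw [braket_smul_right, braket_branch, if_neg hne.symm, mul_zero]
  · exact fun h => (h hy).elim

theorem sum_sq_eq_one (horth : OrthonormalOn A κ P) {x : Fin N} (hx : x ∈ A) :
    ∑ y ∈ A, κ x y ^ 2 = 1 := by
  have h := horth x hx x hx
  rw [if_pos rfl] at h
  simp only [braket_run_run, braket_ket, ket_apply, if_true, mul_one] at h
  have h' : ∑ y ∈ A, κ x y * κ x y = 1 := by exact_mod_cast h
  simpa [sq] using h'

theorem two_mul_braket_mirror_inState (henc : Injective enc) (x x' : Fin N) :
    2 * braket (mirror l L enc A κ P x) (inState l L enc x') =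
      if x = x' then ((√2 : ℝ) : ℂ) else 0 := by
  have h2 : (2 : ℝ) * (√2)⁻¹ = √2 := by
    rw [← div_eq_mul_inv, Real.div_sqrt]
  rw [mirror, braket_real_smul_left, braket_sub_left, braket_inState henc,
    ← star_braket (inState l L enc x'), braket_inState_outState, star_zero, sub_zero, ← mul_assoc]
  split_ifs
  · rw [mul_one]; exact_mod_cast h2
  · rw [mul_zero]

theorem braket_mirror_outState (horth : OrthonormalOn A κ P) {x x' : Fin N}
    (hx : x ∈ A) (hx' : x' ∈ A) (hne : x ≠ x') :
    braket (mirror l L enc A κ P x) (outState l L enc A κ P x') = 0 := by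
  rw [mirror, braket_real_smul_left, braket_sub_left, braket_inState_outState,
    braket_outState horth hx hx', if_neg hne, sub_zero, mul_zero]

theorem mirror_inState (henc : Injective enc) (x : Fin N) :
    inState l L enc x - (2 * braket (mirror l L enc A κ P x) (inState l L enc x)) •
      mirror l L enc A κ P x = outState l L enc A κ P x := by
  rw [two_mul_braket_mirror_inState henc, if_pos rfl, mirror, smul_smul]
  have : ((√2 : ℝ) : ℂ) * (((√2)⁻¹ : ℝ) : ℂ) = 1 := by
    rw [← Complex.ofReal_mul, mul_inv_cancel₀ (by simp), Complex.ofReal_one]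
  rw [this, one_smul, sub_sub_cancel]

/-! ### Supports -/

/-- The configurations that occur in the states `inState x` and `outState x`: the qubits `out y` can be
one only for `y ∈ A`, and the ancilla qubits that are one are all acted on by one of the circuits
`P x y`. -/
def Admissible (A : Finset (Fin N)) (P : Fin N → Fin N → List (Gate (Fin m)))
    (s : Wire n N m l L → Bool) : Prop :=
  ∃ a f o b, s = conf l L a f o b ∧ (∀ y, o y = true → y ∈ A) ∧
    ∃ x ∈ A, ∃ y ∈ A, ∀ q, b q = true → q ∈ wires (P x y)

theorem mem_wires_of_run_ket_zeroConf_ne_zero {gs : List (Gate (Fin m))} {b : Fin m → Bool}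
    (h : run gs (ket zeroConf) b ≠ 0) {q : Fin m} (hq : b q = true) : q ∈ wires gs := by
  obtain ⟨t, ht, htb⟩ := exists_of_run_ne_zero gs h
  by_contra hqw
  rw [ket_apply] at ht
  have h0 : t = zeroConf := by
    by_contra h'
    simp [h'] at ht
  have := htb q hqw
  rw [h0, hq] at this
  simp [zeroConf] at this

theorem eq_conf_of_inState_ne_zero {x : Fin N} {s : Wire n N m l L → Bool}
    (h : inState l L enc x s ≠ 0) : s = conf l L (enc x) true (fun _ => false) fun _ => false := by
  obtain ⟨h1, h2⟩ := eq_conf_of_lift_ne_zero h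
  have h0 : s ∘ ancWire n N l L = zeroConf := by
    by_contra h'
    rw [ket_apply, if_neg h'] at h2
    exact h2 rfl
  rw [h1, h0]
  rfl

theorem admissible_of_inState_ne_zero {x : Fin N} (hx : x ∈ A) {s : Wire n N m l L → Bool}
    (h : inState l L enc x s ≠ 0) : Admissible A P s :=
  ⟨_, _, _, _, eq_conf_of_inState_ne_zero h, by simp, x, hx, x, hx, by simp⟩

theorem exists_of_outState_ne_zero {x : Fin N} {s : Wire n N m l L → Bool}
    (h : outState l L enc A κ P x s ≠ 0) : ∃ y ∈ A, ∃ b,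
      s = conf l L (enc y) false (hot y) b ∧ ∀ q, b q = true → q ∈ wires (P x y) := by
  rw [outState, Finset.sum_apply] at h
  obtain ⟨y, hy, hne⟩ := Finset.exists_ne_zero_of_sum_ne_zero h
  obtain ⟨h1, h2⟩ := eq_conf_of_lift_ne_zero (right_ne_zero_of_mul hne)
  exact ⟨y, hy, _, h1, fun q hq => mem_wires_of_run_ket_zeroConf_ne_zero h2 hq⟩

theorem admissible_of_outState_ne_zero {x : Fin N} (hx : x ∈ A) {s : Wire n N m l L → Bool}
    (h : outState l L enc A κ P x s ≠ 0) : Admissible A P s := by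
  obtain ⟨y, hy, b, hs, hb⟩ := exists_of_outState_ne_zero h
  exact ⟨_, _, _, _, hs, fun z hz => by simpa [hot] using (by simpa [hot] using hz : z = y) ▸ hy,
    x, hx, y, hy, hb⟩

theorem anc_mem_touched_of_mirror_ne_zero {x : Fin N} {s : Wire n N m l L → Bool}
    (h : mirror l L enc A κ P x s ≠ 0) {q : Fin m} (hq : s (.inr (.anc q)) = true) :
    q ∈ touched A P x := by
  rw [mirror, Pi.smul_apply, Pi.sub_apply] at h
  have h := right_ne_zero_of_mul h
  by_cases h1 : inState l L enc x s = 0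
  · rw [h1, zero_sub, neg_ne_zero] at h
    obtain ⟨y, hy, b, rfl, hb⟩ := exists_of_outState_ne_zero h
    exact Finset.mem_biUnion.2 ⟨y, hy, hb q hq⟩
  · rw [eq_conf_of_inState_ne_zero h1] at hq
    simp [conf] at hq

/-! ### Preparation of the mirror vectors -/

/-- The vector `mirror x` is a superposition over the positions of the one-hot qubit: the flag for the
input, and `out y` for the branch of the output at `y`. Controlled by that qubit, the system register is
set to `x` or `y` and the ancilla is prepared. -/
theorem exists_prepare_mirror (horth : OrthonormalOn A κ P) {x : Fin N} (hx : x ∈ A) {k : ℕ}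
    (hk : ∀ y ∈ A, (P x y).length ≤ k) :
    ∃ Q : List (Gate (Wire n N m l L)), Q.length ≤ A.card + 1 + 7 * (n + A.card * (k + n)) ∧
      wires Q ⊆ mirrorWires A P n l L x ∧ run Q (ket zeroConf) = mirror l L enc A κ P x := by
  choose X hXl hXw hXr using fun y : Fin N =>
    exists_xorSys_circuit (n := n) (N := N) (m := m) (l := l) (L := L) (enc y)
  let out : Fin N → Wire n N m l L := fun y => .inr (.out y)
  have hout : Injective out := by intro a b h; simpa [out] using h
  let D : Wire n N m l L → List (Gate (Wire n N m l L))
    | .inr .flag => X x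
    | .inr (.out y) => (P x y).map (Gate.map (ancWire n N l L) ancWire_injective) ++ X y
    | _ => []
  let α : Wire n N m l L → ℝ
    | .inr (.out y) => -((√2)⁻¹ * κ x y)
    | _ => 0
  have hflag : (.inr .flag : Wire n N m l L) ∉ A.image out := by simp [out]
  have hDw : ∀ q, wires (D q) ⊆ Finset.univ.image Sum.inl ∪ Finset.univ.image (ancWire n N l L) := by
    rintro (i | (_ | y | r | c | i))
    · simp [D]
    · exact (hXw x).trans Finset.subset_union_left
    · simp only [D, wires_append, wires_map]
      refine Finset.union_subset ((Finset.image_subset_image (Finset.subset_univ _)).trans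
        Finset.subset_union_right) ((hXw y).trans Finset.subset_union_left)
    all_goals simp [D]
  have hs2 : (√2 : ℝ) ^ 2 = 2 := Real.sq_sqrt (by norm_num)
  have hnorm : (√2 : ℝ)⁻¹ ^ 2 + ∑ q ∈ A.image out, α q ^ 2 = 1 := by
    rw [Finset.sum_image fun a _ b _ h => hout h]
    have : ∀ y, α (out y) ^ 2 = 2⁻¹ * κ x y ^ 2 := by
      intro y
      simp only [α, out, neg_sq, mul_pow, inv_pow, hs2]
    simp only [this, ← Finset.mul_sum, sum_sq_eq_one horth hx, inv_pow, hs2]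
    norm_num
  obtain ⟨Q, hQl, hQw, hQr⟩ := exists_superposition (.inr .flag) (A.image out) hflag (√2)⁻¹
    (by positivity) α hnorm D (by
      intro q _ r hr hr'
      have := hDw q hr'
      simp only [Finset.mem_insert, Finset.mem_image] at hr
      rcases hr with rfl | ⟨y, -, rfl⟩ <;> simp [ancWire, out] at this)
  refine ⟨Q, ?_, ?_, ?_⟩
  · refine hQl.trans ?_
    have h1 : (A.image out).card = A.card := Finset.card_image_of_injective _ hout
    have h2 : ∑ q ∈ insert (.inr .flag) (A.image out), (D q).length ≤ n + A.card * (k + n) := by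
      rw [Finset.sum_insert hflag, Finset.sum_image fun a _ b _ h => hout h]
      refine add_le_add (hXl x) ?_
      rw [← smul_eq_mul]
      refine Finset.sum_le_card_nsmul _ _ _ fun y hy => ?_
      simp only [D, out, List.length_append, List.length_map]
      exact add_le_add (hk y hy) (hXl y)
    rw [h1]
    omega
  · intro q hq
    have hq := hQw hq
    rw [Finset.mem_union, Finset.mem_insert, Finset.mem_biUnion] at hq
    simp only [mirrorWires, Finset.mem_union, Finset.mem_singleton]
    rcases hq with (hq | hq) | ⟨r, hr, hq⟩
    · exact Or.inl (Or.inl (Or.inr hq))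
    · exact Or.inl (Or.inr hq)
    · rw [Finset.mem_insert, Finset.mem_image] at hr
      rcases hr with rfl | ⟨y, hy, rfl⟩
      · exact Or.inl (Or.inl (Or.inl (hXw x hq)))
      · simp only [D, out, wires_append, wires_map, Finset.mem_union] at hq
        rcases hq with hq | hq
        · refine Or.inr (Finset.image_subset_image ?_ hq)
          exact Finset.subset_biUnion_of_mem (fun y => wires (P x y)) hy
        · exact Or.inl (Or.inl (Or.inl (hXw y hq)))
  · have hin : run (D (.inr .flag)) (ket (hotConf (.inr .flag))) = inState l L enc x := by
      have : (hotConf (.inr .flag) : Wire n N m l L → Bool) =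
          conf l L (fun _ => false) true (fun _ => false) fun _ => false := by
        ext w
        rcases w with i | (_ | y | r | c | i) <;> simp [hotConf, zeroConf, conf]
      rw [this, ket_eq_lift (f := ancWire n N l L)]
      simp only [D, hXr, lift_comp_xorSys, Bool.false_xor]
      rfl
    have hbr : ∀ y, run (D (out y)) (ket (hotConf (out y))) =
        branch l L enc y (run (P x y) (ket zeroConf)) := by
      intro y
      have : (hotConf (out y) : Wire n N m l L → Bool) =
          conf l L (fun _ => false) false (hot y) fun _ => false := by
        ext w
        rcases w with i | (_ | z | r | c | i) <;>
          simp [hotConf, zeroConf, conf, out, hot, Function.update_apply]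
      rw [this, ket_eq_lift (f := ancWire n N l L)]
      simp only [D, out, run_append, run_map_lift, hXr, lift_comp_xorSys, Bool.false_xor]
      rfl
    rw [hQr, hin, Finset.sum_image fun a _ b _ h => hout h, mirror, smul_sub, sub_eq_add_neg,
      outState, Finset.smul_sum, ← Finset.sum_neg_distrib]
    congr 1
    refine Finset.sum_congr rfl fun y _ => ?_
    rw [hbr, smul_smul, ← neg_smul]
    simp [α, out]

end Cycle

section CycleCircuit

variable {N m n l L : ℕ} {enc : Fin N → Fin n → Bool} {A : Finset (Fin N)}
  {κ : Fin N → Fin N → ℝ} {P : Fin N → Fin N → List (Gate (Fin m))}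

/-! ### Reflections tested on few qubits -/

/-- The qubits of the chain, as a list. -/
def chainList (n N m l L : ℕ) : List (Wire n N m l L) :=
  (List.finRange L).map fun i => .inr (.chain i)

theorem nodup_chainList : (chainList n N m l L).Nodup :=
  (List.nodup_finRange L).map fun a b h => by simpa using h

theorem length_chainList : (chainList n N m l L).length = L := by simp [chainList]

theorem mem_chainList {w : Wire n N m l L} :
    w ∈ chainList n N m l L ↔ ∃ i, w = .inr (.chain i) := by
  simp [chainList, eq_comm]

/-- Once the parities of the colour classes of `D` are stored in the qubits `hash c`, and these are all
zero, no ancilla qubit in `D` is one, provided that the ancilla qubits that are one have different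
colours. -/
theorem anc_eq_false_of_hash_eq_false {χ : Fin m → Fin l} {D : Finset (Fin m)}
    {s : Wire n N m l L → Bool} (hs : ∀ c, s (.inr (.hash c)) = false)
    (hinj : Set.InjOn χ {q | s (.inr (.anc q)) = true})
    (h : ∀ c, hashMap χ D s (.inr (.hash c)) = false) {q : Fin m} (hq : q ∈ D) :
    s (.inr (.anc q)) = false := by
  by_contra hne
  rw [Bool.not_eq_false] at hne
  have h1 := h (χ q)
  have h2 : (D.filter fun r => χ r = χ q ∧ s (.inr (.anc r)) = true) = {q} := by
    ext r
    simp only [Finset.mem_filter, Finset.mem_singleton]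
    constructor
    · rintro ⟨-, hr, hr'⟩
      exact hinj hr' hne hr
    · rintro rfl
      exact ⟨hq, rfl, hne⟩
  rw [hashMap_hash, h2, hs] at h1
  simp at h1

/-- The reflection about `mirror x`, conjugated by the computation of all parities. The parities let the
zero test ignore the ancilla qubits outside `touched A P x`. -/
theorem exists_hashed_reflection (χ : Fin m → Fin l)
    (hχ : ∀ x ∈ A, ∀ y ∈ A, Set.InjOn χ (wires (P x y))) (horth : OrthonormalOn A κ P)
    {x : Fin N} (hx : x ∈ A) {k : ℕ} (hk : ∀ y ∈ A, (P x y).length ≤ k)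
    (hL : n + 1 + A.card + 2 * (A.card * k) + l < L) :
    ∃ gs : List (Gate (Wire n N m l L)),
      gs.length ≤ 4 * (A.card * k) + 2 * (A.card + 1 + 7 * (n + A.card * (k + n))) +
        14 * (n + 1 + A.card + 2 * (A.card * k) + l) + 3 ∧
      ∀ v, (∀ s, v s ≠ 0 → Admissible A P s) →
        run gs (v ∘ hashMap χ (allTouched A P)) =
          (v - (2 * braket (mirror l L enc A κ P x) v) • mirror l L enc A κ P x) ∘
            hashMap χ (allTouched A P) := by
  obtain ⟨Q, hQl, hQw, hQr⟩ := exists_prepare_mirror (l := l) (L := L) (enc := enc) horth hx hk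
  obtain ⟨H, hHl, hHr⟩ := exists_hash_circuit (n := n) (N := N) (L := L) χ (touched A P x)
  set T := touched A P x with hT
  set U := allTouched A P with hU
  have hTU : T ⊆ U := Finset.subset_biUnion_of_mem (touched A P) hx
  have hTc : T.card ≤ 2 * (A.card * k) := by
    have := Finset.card_biUnion_le_card_mul A (fun y => wires (P x y)) (2 * k) fun y hy =>
      (card_wires_le _).trans (Nat.mul_le_mul_left 2 (hk y hy))
    calc T.card ≤ A.card * (2 * k) := this
      _ = 2 * (A.card * k) := by ring
  let Z : Finset (Wire n N m l L) :=
    mirrorWires A P n l L x ∪ Finset.univ.image (fun c => Sum.inr (Work.hash c))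
  have hZc : Z.card ≤ n + 1 + A.card + 2 * (A.card * k) + l := by
    refine (Finset.card_union_le _ _).trans (add_le_add ?_ ?_)
    · refine (Finset.card_union_le _ _).trans (add_le_add ?_ (Finset.card_image_le.trans hTc))
      refine (Finset.card_union_le _ _).trans (add_le_add ?_ Finset.card_image_le)
      refine (Finset.card_union_le _ _).trans (add_le_add ?_ (by simp))
      exact Finset.card_image_le.trans (by simp)
    · exact Finset.card_image_le.trans (by simp)
  obtain ⟨G, hGl, hGr⟩ := exists_reflection Q (mirrorWires A P n l L x) Z.toList
    (chainList n N m l L)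
    (by rw [Finset.length_toList, length_chainList]; exact hZc.trans_lt hL) nodup_chainList
    (by
      intro z hz hz'
      obtain ⟨i, rfl⟩ := mem_chainList.1 hz'
      simp [Z, mirrorWires, ancWire] at hz)
    hQw (fun q hq => Finset.mem_toList.2 (Finset.mem_union_left _ hq))
  rw [hQr] at hGr
  -- Adding the parities over `T` to those over `U` leaves the parities over `U \ T`; these do not
  -- affect `mirror x`, whose ancilla is supported on `T`.
  refine ⟨H ++ G ++ H, ?_, fun v hv => ?_⟩
  · rw [Finset.length_toList] at hGl
    simp only [List.length_append]
    omega
  set w := mirror l L enc A κ P x with hw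
  have hsd : symmDiff U T = U \ T := by
    rw [symmDiff_def, Finset.sup_eq_union, Finset.sdiff_eq_empty_iff_subset.2 hTU,
      Finset.union_empty]
  have hsd' : symmDiff (U \ T) T = U := by
    rw [← hsd, symmDiff_assoc, symmDiff_self, symmDiff_bot]
  have hUT : (v ∘ hashMap χ U) ∘ hashMap χ T = v ∘ hashMap χ (U \ T) := by
    ext s
    rw [Function.comp_apply, Function.comp_apply, hashMap_hashMap, hsd, Function.comp_apply]
  have hUT' : ∀ v' : (Wire n N m l L → Bool) → ℂ,
      (v' ∘ hashMap χ (U \ T)) ∘ hashMap χ T = v' ∘ hashMap χ U := by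
    intro v'
    ext s
    rw [Function.comp_apply, Function.comp_apply, hashMap_hashMap, hsd', Function.comp_apply]
  have hwT : w ∘ hashMap χ (U \ T) = w := by
    refine comp_hashMap_eq_self _ _ _ fun s hs q hq => ?_
    by_contra h
    rw [Bool.not_eq_false] at h
    exact (Finset.mem_sdiff.1 hq).2 (anc_mem_touched_of_mirror_ne_zero hs h)
  have hclean : CleanOn (chainList n N m l L) (v ∘ hashMap χ (U \ T)) := by
    intro s hs c hc
    obtain ⟨i, rfl⟩ := mem_chainList.1 hc
    obtain ⟨a, f, o, b, h, -⟩ := hv _ hs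
    have := congrFun h (.inr (.chain i))
    rw [hashMap_of_ne _ _ _ _ (by simp)] at this
    rw [this]
    rfl
  have hsupp : ∀ t, (v ∘ hashMap χ (U \ T)) t ≠ 0 →
      (∀ q ∈ Z.toList, q ∉ mirrorWires A P n l L x → t q = false) →
      ∀ q ∉ mirrorWires A P n l L x, t q = false := by
    intro t ht htZ
    obtain ⟨a, f, o, b, h, ho, x', hx', y', hy', hb⟩ := hv _ ht
    have hth : ∀ c, t (.inr (.hash c)) = false := fun c =>
      htZ _ (by simp [Z]) (by simp [mirrorWires, ancWire])
    have htt : t = hashMap χ (U \ T) (conf l L a f o b) := by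
      rw [← h, hashMap_involutive χ (U \ T) t]
    -- The parity qubits of `t` are zero, and by admissibility the ancilla qubits that are one have
    -- different colours. So the ancilla is zero on `U \ T`, and the parities change nothing.
    have hanc : ∀ q ∈ U \ T, (conf l L a f o b : Wire n N m l L → Bool) (.inr (.anc q)) = false :=
      fun q hq => anc_eq_false_of_hash_eq_false (s := conf l L a f o b) (D := U \ T) (fun c => rfl)
        (fun q hq r hr hqr => hχ x' hx' y' hy' (hb q hq) (hb r hr) hqr)
        (fun c => by rw [← htt]; exact hth c) hq
    rw [hashMap_eq_self _ _ _ hanc] at htt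
    subst htt
    rintro (i | (_ | y | q | c | i)) hq
    · simp [mirrorWires] at hq
    · simp [mirrorWires] at hq
    · change o y = false
      by_contra hne
      rw [Bool.not_eq_false] at hne
      exact hq (by simp [mirrorWires, ho y hne])
    · change b q = false
      by_contra hne
      rw [Bool.not_eq_false] at hne
      have hqU : q ∈ U := Finset.mem_biUnion.2 ⟨x', hx', Finset.mem_biUnion.2 ⟨y', hy', hb q hne⟩⟩
      have hqT : q ∉ T := fun hqT => hq (Finset.mem_union_right _ (Finset.mem_image_of_mem _ hqT))
      have := hanc q (Finset.mem_sdiff.2 ⟨hqU, hqT⟩)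
      change b q = false at this
      rw [hne] at this
      exact Bool.noConfusion this
    · rfl
    · rfl
  rw [run_append, run_append, hHr (v ∘ _), hUT, hGr _ hclean hsupp, hHr,
    braket_comp_involutive (hashMap_involutive χ _), hwT]
  have : v ∘ hashMap χ (U \ T) - (2 * braket w v) • w =
      (v - (2 * braket w v) • w) ∘ hashMap χ (U \ T) := by
    conv_lhs => enter [2, 2]; rw [← hwT]
    rfl
  rw [this, hUT']

theorem inState_comp_hashMap (χ : Fin m → Fin l) (D : Finset (Fin m)) (x : Fin N) :
    inState l L enc x ∘ hashMap χ D = inState l L enc x := by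
  refine comp_hashMap_eq_self _ _ _ fun s hs q _ => ?_
  rw [eq_conf_of_inState_ne_zero hs]
  rfl

/-- The product of the reflections about the vectors `mirror x`, `x ∈ A`, maps each `inState x` to
`outState x`, since the states `inState x` and `outState x` are pairwise orthogonal. -/
theorem exists_hashed_reflections (χ : Fin m → Fin l) (henc : Injective enc)
    (hχ : ∀ x ∈ A, ∀ y ∈ A, Set.InjOn χ (wires (P x y))) (horth : OrthonormalOn A κ P)
    {k : ℕ} (hk : ∀ x ∈ A, ∀ y ∈ A, (P x y).length ≤ k)
    (hL : n + 1 + A.card + 2 * (A.card * k) + l < L) (B : Finset (Fin N)) (hB : B ⊆ A) :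
    ∃ gs : List (Gate (Wire n N m l L)),
      gs.length ≤ B.card *
        (4 * (A.card * k) + 2 * (A.card + 1 + 7 * (n + A.card * (k + n))) +
          14 * (n + 1 + A.card + 2 * (A.card * k) + l) + 3) ∧
      ∀ x ∈ A, run gs (inState l L enc x) =
        (if x ∈ B then outState l L enc A κ P x else inState l L enc x) ∘
          hashMap χ (allTouched A P) := by
  induction B using Finset.induction_on with
  | empty => exact ⟨[], by simp, fun x _ => by simp [inState_comp_hashMap]⟩
  | insert z B hz ih =>
    obtain ⟨gs, hl, hr⟩ := ih ((Finset.subset_insert _ _).trans hB)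
    have hzA : z ∈ A := hB (Finset.mem_insert_self _ _)
    obtain ⟨hs, hl', hr'⟩ := exists_hashed_reflection (enc := enc) χ hχ horth hzA (hk z hzA) hL
    refine ⟨gs ++ hs, ?_, fun x hx => ?_⟩
    · rw [List.length_append, Finset.card_insert_of_notMem hz, Nat.add_mul, one_mul]
      exact add_le_add hl hl'
    · rw [run_append, hr x hx, hr']
      · congr 1
        by_cases hxz : x = z
        · subst hxz
          rw [if_neg hz, if_pos (Finset.mem_insert_self _ _), mirror_inState henc]
        · by_cases hxB : x ∈ B
          · rw [if_pos hxB, if_pos (Finset.mem_insert_of_mem hxB),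
              braket_mirror_outState horth hzA hx (Ne.symm hxz), mul_zero, zero_smul, sub_zero]
          · rw [if_neg hxB, if_neg (by simp [hxz, hxB]),
              two_mul_braket_mirror_inState henc, if_neg (Ne.symm hxz), zero_smul, sub_zero]
      · intro s hs
        split_ifs at hs
        · exact admissible_of_outState_ne_zero hx hs
        · exact admissible_of_inState_ne_zero hx hs

/-! ### Erasing the copy of the output -/

/-- The qubit `out y` is flipped when the system register contains `y`. -/
theorem exists_flip_out (y : Fin N) (hL : n < L) :
    ∃ gs : List (Gate (Wire n N m l L)), gs.length ≤ 16 * n + 3 ∧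
      ∀ v, CleanOn (chainList n N m l L) v → ∀ s, run gs v s =
        if (fun i => s (.inl i)) = enc y then
          v (update s (.inr (.out y)) (!s (.inr (.out y)))) else v s := by
  obtain ⟨X, hXl, -, hXr⟩ :=
    exists_xorSys_circuit (n := n) (N := N) (m := m) (l := l) (L := L) (enc y)
  let sys : List (Wire n N m l L) := (List.finRange n).map Sum.inl
  have hsys : sys.length = n := by simp [sys]
  obtain ⟨F, hFl, hFr⟩ := exists_zero_flip (.inr (.out y)) sys (chainList n N m l L)
    (by rw [hsys, length_chainList]; exact hL) nodup_chainList
    (by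
      intro z hz hz'
      obtain ⟨i, rfl⟩ := mem_chainList.1 hz'
      simp [sys] at hz)
    (by simp [mem_chainList]) (by simp [sys])
  -- After adding `enc y`, the system register is zero exactly if it contained `y`.
  refine ⟨X ++ F ++ X, by simp only [List.length_append]; omega, fun v hv s => ?_⟩
  have hclean : CleanOn (chainList n N m l L) (v ∘ xorSys (enc y)) := by
    intro t ht c hc
    obtain ⟨i, rfl⟩ := mem_chainList.1 hc
    exact hv _ ht _ hc
  have hinv : ∀ t : Wire n N m l L → Bool, xorSys (enc y) (xorSys (enc y) t) = t := by
    intro t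
    ext w
    cases w <;> simp [xorSys]
  have hupd : xorSys (enc y) (update (xorSys (enc y) s) (.inr (.out y))
      (!xorSys (enc y) s (.inr (.out y)))) = update s (.inr (.out y)) (!s (.inr (.out y))) := by
    ext w
    rcases w with i | w
    · simp [xorSys]
    · by_cases hw : w = .out y
      · subst hw; simp [xorSys]
      · simp [xorSys, hw]
  rw [run_append, run_append, hXr, hXr, Function.comp_apply, hFr _ hclean, Function.comp_apply,
    Function.comp_apply, hinv, hupd]
  have hiff : (∀ z ∈ sys, xorSys (enc y) s z = false) ↔ (fun i => s (.inl i)) = enc y := by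
    simp only [sys, List.mem_map, List.mem_finRange, true_and, forall_exists_index,
      forall_apply_eq_imp_iff, xorSys, Sum.elim_inl, funext_iff]
    exact forall_congr' fun i => by cases s (.inl i) <;> cases enc y i <;> simp
  by_cases h : (fun i => s (.inl i)) = enc y
  · rw [if_pos h, if_pos (hiff.2 h)]
  · rw [if_neg h, if_neg (mt hiff.1 h)]

/-- In each branch, the system register determines which of the qubits `out y` is one. -/
theorem exists_erase_out (henc : Injective enc) (hL : n < L) (B : Finset (Fin N)) :
    ∃ gs : List (Gate (Wire n N m l L)), gs.length ≤ B.card * (16 * n + 3) ∧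
      ∀ y v, run gs (branch l L enc y v) = if y ∈ B then
        lift (ancWire n N l L) (conf l L (enc y) false (fun _ => false) fun _ => false) v
        else branch l L enc y v := by
  induction B using Finset.induction_on with
  | empty => exact ⟨[], by simp, by simp⟩
  | insert z B hz ih =>
    obtain ⟨gs, hl, hr⟩ := ih
    obtain ⟨hs, hl', hr'⟩ := exists_flip_out (N := N) (m := m) (l := l) (enc := enc) z hL
    have hclean : ∀ (y : Fin N) (o : Fin N → Bool) (v : (Fin m → Bool) → ℂ),
        CleanOn (chainList n N m l L)
          (lift (ancWire n N l L) (conf l L (enc y) false o fun _ => false) v) := by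
      intro y o v s hs c hc
      obtain ⟨i, rfl⟩ := mem_chainList.1 hc
      rw [(eq_conf_of_lift_ne_zero hs).1]
      rfl
    have hkeep : ∀ (y : Fin N) (o : Fin N → Bool) (v : (Fin m → Bool) → ℂ), y ≠ z →
        run hs (lift (ancWire n N l L) (conf l L (enc y) false o fun _ => false) v) =
          lift (ancWire n N l L) (conf l L (enc y) false o fun _ => false) v := by
      intro y o v hyz
      ext s
      rw [hr' _ (hclean y o v)]
      split_ifs with h
      · have h0 : ∀ t : Wire n N m l L → Bool, (fun i => t (.inl i)) = enc z →
            lift (ancWire n N l L) (conf l L (enc y) false o fun _ => false) v t = 0 := by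
          intro t ht
          by_contra hne
          rw [(eq_conf_of_lift_ne_zero hne).1] at ht
          exact hyz (henc ht)
        rw [h0 s h, h0 _ (by simpa using h)]
      · rfl
    refine ⟨gs ++ hs, ?_, fun y v => ?_⟩
    · rw [List.length_append, Finset.card_insert_of_notMem hz, Nat.add_mul, one_mul]
      exact add_le_add hl hl'
    · rw [run_append, hr]
      by_cases hyz : y = z
      · subst hyz
        rw [if_neg hz, if_pos (Finset.mem_insert_self _ _)]
        ext s
        rw [branch, hr' _ (hclean y _ v)]
        have hne : ∀ q, q ∈ Set.range (ancWire n N l L : Fin m → Wire n N m l L) →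
            q ≠ .inr (.out y) := by
          rintro q ⟨r, rfl⟩
          simp [ancWire]
        by_cases hs : (fun i => s (.inl i)) = enc y
        · rw [if_pos hs]
          unfold lift
          have hcomp : update s (.inr (.out y)) (!s (.inr (.out y))) ∘ ancWire n N l L =
              s ∘ ancWire n N l L := by
            ext r
            simp [ancWire]
          rw [hcomp]
          refine if_congr (forall₂_congr fun q _ => ?_) rfl rfl
          rcases q with i | (_ | r | r | c | i)
          · simp [conf]
          · simp [conf]
          · by_cases hry : r = y
            · subst hry; simp [conf, hot]
            · simp [conf, hot, hry]
          all_goals simp [conf]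
        · rw [if_neg hs]
          have h0 : ∀ o : Fin N → Bool,
              lift (ancWire n N l L) (conf l L (enc y) false o fun _ => false) v s = 0 := by
            intro o
            by_contra hne
            refine hs ?_
            rw [(eq_conf_of_lift_ne_zero hne).1]
            rfl
          rw [h0, h0]
      · by_cases hyB : y ∈ B
        · rw [if_pos hyB, if_pos (Finset.mem_insert_of_mem hyB), hkeep _ _ _ hyz]
        · rw [if_neg hyB, if_neg (by simp [hyz, hyB]), branch, hkeep _ _ _ hyz]

/-! ### The circuit for one cycle -/

/-- The flag is raised to mark the input, the reflections lower it again, and after that the parities and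
the one-hot copy of the output are erased. No parities have to be computed at the beginning, because
the ancilla of the input is zero. -/
theorem exists_cycle_circuit_of_coloring (χ : Fin m → Fin l) (henc : Injective enc)
    (hχ : ∀ x ∈ A, ∀ y ∈ A, Set.InjOn χ (wires (P x y))) (horth : OrthonormalOn A κ P)
    {k : ℕ} (hk : ∀ x ∈ A, ∀ y ∈ A, (P x y).length ≤ k)
    (hL : n + 1 + A.card + 2 * (A.card * k) + l < L) :
    ∃ gs : List (Gate (Wire n N m l L)),
      gs.length ≤ 1 + A.card *
        (4 * (A.card * k) + 2 * (A.card + 1 + 7 * (n + A.card * (k + n))) +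
          14 * (n + 1 + A.card + 2 * (A.card * k) + l) + 3) + 2 * (A.card * (A.card * k)) +
          A.card * (16 * n + 3) ∧
      ∀ x ∈ A, run gs (ket (conf l L (enc x) false (fun _ => false) fun _ => false)) =
        ∑ y ∈ A, (κ x y : ℂ) • lift (ancWire n N l L)
          (conf l L (enc y) false (fun _ => false) fun _ => false)
          (run (P x y) (ket zeroConf)) := by
  obtain ⟨R, hRl, hRr⟩ := exists_hashed_reflections (enc := enc) χ henc hχ horth hk hL A subset_rfl
  obtain ⟨H, hHl, hHr⟩ := exists_hash_circuit (n := n) (N := N) (L := L) χ (allTouched A P)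
  obtain ⟨E, hEl, hEr⟩ := exists_erase_out (N := N) (m := m) (l := l) (L := L) henc (by omega) A
  have hUc : (allTouched A P).card ≤ 2 * (A.card * (A.card * k)) := by
    have h1 : ∀ x ∈ A, (touched A P x).card ≤ A.card * (2 * k) := fun x hx =>
      Finset.card_biUnion_le_card_mul A (fun y => wires (P x y)) (2 * k) fun y hy =>
        (card_wires_le _).trans (Nat.mul_le_mul_left 2 (hk x hx y hy))
    calc (allTouched A P).card ≤ A.card * (A.card * (2 * k)) :=
          Finset.card_biUnion_le_card_mul A (touched A P) _ h1
      _ = 2 * (A.card * (A.card * k)) := by ring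
  refine ⟨notGate (.inr .flag) :: (R ++ H ++ E), ?_, fun x hx => ?_⟩
  · simp only [List.length_cons, List.length_append]
    omega
  · have hin : (notGate (.inr .flag : Wire n N m l L)).toMatrix *ᵥ
        ket (conf l L (enc x) false (fun _ => false) fun _ => false) = inState l L enc x := by
      rw [inState]
      have : (zeroConf : Fin m → Bool) =
          conf l L (enc x) true (fun _ => false) (fun _ => false) ∘ ancWire n N l L := rfl
      rw [this, ← ket_eq_lift]
      ext s
      rw [notGate_mulVec, ket_apply, ket_apply]
      refine if_congr ?_ rfl rfl
      constructor
      · intro h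
        ext w
        have hw := congrFun h w
        by_cases hwf : w = .inr .flag
        · subst hwf
          rw [update_self] at hw
          simpa [conf] using hw
        · rw [update_of_ne hwf] at hw
          rw [hw]
          rcases w with i | (_ | y | q | c | i) <;> first | rfl | exact (hwf rfl).elim
      · rintro rfl
        ext w
        rcases w with i | (_ | y | q | c | i) <;> simp [conf]
    have hHH : ∀ v : (Wire n N m l L → Bool) → ℂ,
        (v ∘ hashMap χ (allTouched A P)) ∘ hashMap χ (allTouched A P) = v := by
      intro v
      ext s
      rw [Function.comp_apply, Function.comp_apply, hashMap_involutive χ _ s]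
    rw [run_cons, hin, run_append, run_append, hRr x hx, hHr, hHH, if_pos hx, outState, run_sum]
    refine Finset.sum_congr rfl fun y hy => ?_
    rw [run_smul, hEr, if_pos hy]

end CycleCircuit

/-! ### Uniform bounds -/

/-- The number of colours of ancilla qubits for cycles of length at most `d` and preparation circuits
with at most `k` gates. -/
abbrev numColors (d k : ℕ) : ℕ := d * (2 * k) + 1

/-- The number of qubits in which conjunctions are computed. -/
abbrev chainLength (n d k : ℕ) : ℕ := n + 1 + d + 2 * (d * k) + numColors d k + 1

/-- The cost of `exists_cycle_circuit_of_coloring` for a cycle of length `r` is quadratic in `d`. The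
number of colours is of order `d * k`, and is not multiplied by more than the number of reflections. -/
theorem gate_count_bound {r d n k : ℕ} (hr : r ≤ d) (hd : 1 ≤ d) :
    1 + r * (4 * (r * k) + 2 * (r + 1 + 7 * (n + r * (k + n))) +
      14 * (n + 1 + r + 2 * (r * k) + numColors d k) + 3) + 2 * (r * (r * k)) +
      r * (16 * n + 3) ≤ 90 * (d * (d * (n + k + 1))) := by
  have h1 : 1 + r * (4 * (r * k) + 2 * (r + 1 + 7 * (n + r * (k + n))) +
      14 * (n + 1 + r + 2 * (r * k) + numColors d k) + 3) + 2 * (r * (r * k)) +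
      r * (16 * n + 3) ≤
      1 + d * (4 * (d * k) + 2 * (d + 1 + 7 * (n + d * (k + n))) +
      14 * (n + 1 + d + 2 * (d * k) + numColors d k) + 3) + 2 * (d * (d * k)) +
      d * (16 * n + 3) := by gcongr
  have hn : n ≤ d * n := Nat.le_mul_of_pos_left n hd
  have h2 : 4 * (d * k) + 2 * (d + 1 + 7 * (n + d * (k + n))) +
      14 * (n + 1 + d + 2 * (d * k) + numColors d k) + 3 + 2 * (d * k) + (16 * n + 3) + 1 ≤
      90 * (d * (n + k + 1)) := by
    have e1 : d * (n + k + 1) = d * n + d * k + d := by ring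
    have e2 : d * (k + n) = d * n + d * k := by ring
    have e3 : d * (2 * k) = 2 * (d * k) := by ring
    rw [numColors, e1, e2, e3]
    omega
  calc _ ≤ _ := h1
    _ ≤ d * (4 * (d * k) + 2 * (d + 1 + 7 * (n + d * (k + n))) +
      14 * (n + 1 + d + 2 * (d * k) + numColors d k) + 3 + 2 * (d * k) + (16 * n + 3) + 1) := by
        have gen : ∀ X Y : ℕ,
            1 + d * X + 2 * (d * (d * k)) + d * Y ≤ d * (X + 2 * (d * k) + Y + 1) := by
          intro X Y
          have e : d * (X + 2 * (d * k) + Y + 1) = d * X + 2 * (d * (d * k)) + d * Y + d := by ring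
          omega
        exact gen _ _
    _ ≤ d * (90 * (d * (n + k + 1))) := Nat.mul_le_mul_left d h2
    _ = _ := by ring

/-- The circuit for one cycle, with a cost and a number of work qubits that depend only on the bounds
`d` and `k`, so that the circuits of all cycles act on the same qubits. -/
theorem exists_cycle_circuit {N m n d k : ℕ} (hd : 1 ≤ d) {enc : Fin N → Fin n → Bool}
    (henc : Injective enc) {A : Finset (Fin N)} (hA : A.card ≤ d) {κ : Fin N → Fin N → ℝ}
    {P : Fin N → Fin N → List (Gate (Fin m))} (horth : OrthonormalOn A κ P)
    (hk : ∀ x ∈ A, ∀ y ∈ A, (P x y).length ≤ k) :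
    ∃ gs : List (Gate (Wire n N m (numColors d k) (chainLength n d k))),
      gs.length ≤ 90 * (d * (d * (n + k + 1))) ∧
      ∀ x ∈ A, run gs (ket (conf _ _ (enc x) false (fun _ => false) fun _ => false)) =
        ∑ y ∈ A, (κ x y : ℂ) • lift (ancWire n N _ _)
          (conf _ _ (enc y) false (fun _ => false) fun _ => false)
          (run (P x y) (ket zeroConf)) := by
  obtain ⟨χ, hχ⟩ := exists_coloring (A ×ˢ A) (fun p => wires (P p.1 p.2)) d (2 * k)
    (by rw [Finset.card_product]; exact Nat.mul_le_mul hA hA)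
    (fun p hp => (card_wires_le _).trans (Nat.mul_le_mul_left 2
      (hk _ (Finset.mem_product.1 hp).1 _ (Finset.mem_product.1 hp).2))) Finset.univ
  obtain ⟨gs, hl, hr⟩ := exists_cycle_circuit_of_coloring (L := chainLength n d k) χ henc
    (fun x hx y hy => by simpa using hχ (x, y) (Finset.mem_product.2 ⟨hx, hy⟩)) horth hk
    (by
      have : A.card * k ≤ d * k := Nat.mul_le_mul_right k hA
      simp only [chainLength, numColors]
      omega)
  exact ⟨gs, hl.trans (gate_count_bound hA hd), hr⟩

/-! ### Algorithms -/

section Algorithm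

variable {N w : ℕ} (S : Fin N → Finset (Fin N))

theorem query_mulVec (Φ : Config N w → ℂ) (s : Qubits N w → Bool) (A : Finset (Fin N)) :
    ((Step.query : Step N w).toMatrix S *ᵥ Φ) (s, A) = Φ (s, symmDiff A (answer S s)) := by
  rw [Matrix.mulVec, dotProduct, Finset.sum_eq_single (s, symmDiff A (answer S s))]
  · simp [Step.toMatrix]
  · rintro ⟨t, B⟩ _ hne
    simp only [Step.toMatrix, Matrix.of_apply]
    rw [if_neg, zero_mul]
    rintro ⟨rfl, rfl⟩
    simp at hne
  · simp

theorem gate_mulVec (g : Finset (Fin N) → Gate (Qubits N w)) (Φ : Config N w → ℂ)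
    (s : Qubits N w → Bool) (A : Finset (Fin N)) :
    ((Step.gate g).toMatrix S *ᵥ Φ) (s, A) = ((g A).toMatrix *ᵥ fun t => Φ (t, A)) s := by
  rw [Matrix.mulVec, dotProduct, Fintype.sum_prod_type, Matrix.mulVec, dotProduct]
  refine Finset.sum_congr rfl fun t _ => ?_
  rw [Finset.sum_eq_single A]
  · simp [Step.toMatrix]
  · intro B _ hB
    simp [Step.toMatrix, hB.symm]
  · simp

/-- A family of circuits of bounded length, indexed by the content of the answer register, is a
sequence of gate steps; shorter circuits are padded with the trivial gate on the qubit `q₀`. -/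
theorem exists_gate_steps (q₀ : Qubits N w) (M : ℕ)
    (G : Finset (Fin N) → List (Gate (Qubits N w))) (hG : ∀ A, (G A).length ≤ M) :
    ∃ steps : List (Step N w), queryCount steps = 0 ∧ gateCount steps = M ∧
      ∀ Φ s A, (runMatrix S steps *ᵥ Φ) (s, A) = run (G A) (fun t => Φ (t, A)) s := by
  induction M generalizing G with
  | zero =>
    refine ⟨[], rfl, rfl, fun Φ s A => ?_⟩
    have : G A = [] := List.length_eq_zero_iff.1 (Nat.le_zero.1 (hG A))
    simp [this, runMatrix]
  | succ M ih =>
    obtain ⟨steps, hq, hg, hr⟩ := ih (fun A => (G A).tail) (fun A => by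
      have := hG A
      simp only [List.length_tail]
      omega)
    refine ⟨.gate (fun A => (G A).headD (.one q₀ 1)) :: steps, hq, by simp [gateCount, hg],
      fun Φ s A => ?_⟩
    rw [runMatrix, ← Matrix.mulVec_mulVec, hr]
    simp only [gate_mulVec]
    cases h : G A with
    | nil => simp [one_one_mulVec]
    | cons g gs => simp [run_cons]

theorem queryCount_append (p q : List (Step N w)) :
    queryCount (p ++ q) = queryCount p + queryCount q := by
  induction p with
  | nil => simp [queryCount]
  | cons a p ih => cases a <;> simp [queryCount, ih, Nat.add_right_comm]

theorem gateCount_append (p q : List (Step N w)) :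
    gateCount (p ++ q) = gateCount p + gateCount q := by
  induction p with
  | nil => simp [gateCount]
  | cons a p ih => cases a <;> simp [gateCount, ih, Nat.add_right_comm]

theorem runMatrix_append (p q : List (Step N w)) :
    runMatrix S (p ++ q) = runMatrix S q * runMatrix S p := by
  induction p with
  | nil => simp [runMatrix]
  | cons a p ih => simp [runMatrix, ih, Matrix.mul_assoc]

theorem encode_injective : Injective (encode : Fin N → _) := by
  intro x y h
  refine Fin.ext (Nat.eq_of_testBit_eq fun i => ?_)
  by_cases hi : i < Nat.clog 2 N
  · exact congrFun h ⟨i, hi⟩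
  · have hN : N ≤ 2 ^ i :=
      (Nat.le_pow_clog one_lt_two N).trans (Nat.pow_le_pow_right two_pos (not_lt.1 hi))
    rw [Nat.testBit_lt_two_pow (x.2.trans_le hN), Nat.testBit_lt_two_pow (y.2.trans_le hN)]

variable {S}

theorem answer_encode (x : Fin N) (z : Fin w → Bool) :
    answer S (Sum.elim (encode x) z) = S x := by
  ext y
  unfold answer
  rw [Finset.mem_filter]
  simp only [Finset.mem_univ, true_and, Sum.elim_inl]
  constructor
  · rintro ⟨x', hx', hy⟩
    rwa [← encode_injective hx']
  · exact fun h => ⟨x, rfl, h⟩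

end Algorithm

/-! ### Partial traces -/

section Trace

variable {N m w : ℕ}

/-- The isometry that writes `|y⟩|a⟩` into the system register and the work qubits, the latter in the
encoding `f`, and sets the answer register to the empty set. -/
def outputIsometry (f : (Fin m → Bool) → Fin w → Bool) :
    Matrix (Config N w) (Fin N × (Fin m → Bool)) ℂ :=
  Matrix.of fun p r => if p = (Sum.elim (encode r.1) (f r.2), ∅) then 1 else 0

theorem outputIsometry_apply (f : (Fin m → Bool) → Fin w → Bool) (s : Fin (Nat.clog 2 N) → Bool)
    (z : Fin w → Bool) (A : Finset (Fin N)) (r : Fin N × (Fin m → Bool)) :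
    outputIsometry f (Sum.elim s z, A) r =
      if s = encode r.1 then (if z = f r.2 ∧ A = ∅ then 1 else 0) else 0 := by
  rw [outputIsometry, Matrix.of_apply, ← ite_and]
  refine if_congr ?_ rfl rfl
  rw [Prod.mk.injEq, ← and_assoc]
  refine and_congr_left fun _ => ?_
  constructor
  · intro h
    exact ⟨funext fun i => congrFun h (.inl i), funext fun i => congrFun h (.inr i)⟩
  · rintro ⟨rfl, rfl⟩
    rfl

theorem traceWork_conj_outputIsometry {f : (Fin m → Bool) → Fin w → Bool} (hf : Injective f)
    (M : Matrix (Fin N × (Fin m → Bool)) (Fin N × (Fin m → Bool)) ℂ) :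
    traceWork ((outputIsometry f : Matrix (Config N w) _ ℂ) * M *
        (outputIsometry f : Matrix (Config N w) _ ℂ).conjTranspose) =
      systemIsometry N * traceAncilla M * (systemIsometry N).conjTranspose := by
  ext s t
  simp only [traceWork, Matrix.of_apply, Matrix.mul_apply, Matrix.conjTranspose_apply,
    outputIsometry_apply, systemIsometry, traceAncilla]
  by_cases hs : ∃ y, s = encode y
  · by_cases ht : ∃ y, t = encode y
    · obtain ⟨y, rfl⟩ := hs
      obtain ⟨y', rfl⟩ := ht
      simp only [encode_injective.eq_iff]
      symm
      rw [Finset.sum_eq_single y' (by intro b _ hb; simp [hb.symm]) (by simp),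
        Finset.sum_eq_single y (by intro b _ hb; simp [hb.symm]) (by simp)]
      simp only [if_true, one_mul, star_one, mul_one]
      apply Fintype.sum_of_injective f hf
      · intro z hz
        refine Finset.sum_eq_zero fun A _ => Finset.sum_eq_zero fun r _ => ?_
        have : z ≠ f r.2 := fun h => hz ⟨_, h.symm⟩
        simp [this]
      · intro a
        rw [Finset.sum_eq_single ∅ (by intro A _ hA; simp [hA]) (by simp),
          Finset.sum_eq_single (y', a), Finset.sum_eq_single (y, a)]
        · simp
        · rintro ⟨y₁, a₁⟩ _ hne
          have : ¬ (y = y₁ ∧ a = a₁) := by rintro ⟨rfl, rfl⟩; exact hne rfl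
          simp only [hf.eq_iff, and_true, ← ite_and, this, if_false, zero_mul]
        · simp
        · rintro ⟨y₁, a₁⟩ _ hne
          have : ¬ (y' = y₁ ∧ a = a₁) := by rintro ⟨rfl, rfl⟩; exact hne rfl
          simp only [hf.eq_iff, and_true, ← ite_and, this, if_false, star_zero, mul_zero]
        · simp
    · have ht' : ∀ y, t ≠ encode y := fun y h => ht ⟨y, h⟩
      simp [ht']
  · have hs' : ∀ y, s ≠ encode y := fun y h => hs ⟨y, h⟩
    simp [hs']

end Trace

/-! ### Transport to numbered work qubits -/

section Transport

variable {N m l L w : ℕ}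

/-- A numbering of the work qubits, extended by the identity on the system register. -/
def numbering (e : Work N m l L ≃ Fin w) : Wire (Nat.clog 2 N) N m l L → Qubits N w := Sum.map id e

theorem numbering_injective (e : Work N m l L ≃ Fin w) : Injective (numbering e) :=
  Function.Injective.sumMap Function.injective_id e.injective

/-- The content of the numbered work qubits when the ancilla contains `a` and all other work qubits
are zero. -/
def ancEncoding (e : Work N m l L ≃ Fin w) (a : Fin m → Bool) : Fin w → Bool := fun j =>
  conf (n := 0) (N := N) l L (fun _ => false) false (fun _ => false) a (.inr (e.symm j))

theorem ancEncoding_injective (e : Work N m l L ≃ Fin w) : Injective (ancEncoding e) := by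
  intro a b h
  ext q
  have := congrFun h (e (.anc q))
  simpa [ancEncoding, conf] using this

theorem sum_elim_comp_numbering (e : Work N m l L ≃ Fin w) (a : Fin (Nat.clog 2 N) → Bool)
    (b : Fin m → Bool) :
    Sum.elim a (ancEncoding e b) ∘ numbering e = conf l L a false (fun _ => false) b := by
  ext q
  rcases q with i | q
  · rfl
  · change ancEncoding e b (e q) = _
    rw [ancEncoding, e.symm_apply_apply]
    rfl

theorem comp_numbering_injective (e : Work N m l L ≃ Fin w) :
    Injective fun s : Qubits N w → Bool => s ∘ numbering e := by
  intro s t h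
  ext q
  rcases q with i | j
  · exact congrFun h (.inl i)
  · have := congrFun h (.inr (e.symm j))
    simpa [numbering] using this

theorem lift_numbering (e : Work N m l L ≃ Fin w) (c : Qubits N w → Bool)
    (v : (Wire (Nat.clog 2 N) N m l L → Bool) → ℂ) :
    lift (numbering e) c v = fun s => v (s ∘ numbering e) := by
  ext s
  unfold lift
  rw [if_pos]
  rintro (i | j) hq
  · exact (hq ⟨.inl i, rfl⟩).elim
  · exact (hq ⟨.inr (e.symm j), by simp [numbering]⟩).elim

/-- A state in which only the ancilla is not a basis state, as a sum over the contents of the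
ancilla. -/
theorem lift_conf_comp_numbering (e : Work N m l L ≃ Fin w) (a : Fin (Nat.clog 2 N) → Bool)
    (v : (Fin m → Bool) → ℂ) (s : Qubits N w → Bool) :
    lift (ancWire _ N l L) (conf l L a false (fun _ => false) fun _ => false) v
        (s ∘ numbering e) =
      ∑ b, if s = Sum.elim a (ancEncoding e b) then v b else 0 := by
  have hiff : ∀ b, s = Sum.elim a (ancEncoding e b) ↔
      s ∘ numbering e = conf l L a false (fun _ => false) b := by
    intro b
    rw [← sum_elim_comp_numbering e]
    exact (comp_numbering_injective e).eq_iff.symm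
  simp only [hiff]
  set t := s ∘ numbering e
  by_cases h : t = conf l L a false (fun _ => false) (t ∘ ancWire _ N l L)
  · rw [Finset.sum_eq_single (t ∘ ancWire _ N l L), if_pos h]
    · unfold lift
      rw [if_pos]
      intro q hq
      rw [h]
      rcases q with i | (_ | y | k | c | i) <;> first | rfl | exact (hq ⟨k, rfl⟩).elim
    · intro b _ hb
      rw [if_neg]
      intro h'
      exact hb (by rw [h']; rfl)
    · simp
  · rw [Finset.sum_eq_zero]
    · by_contra hne
      exact h (eq_conf_of_lift_ne_zero hne).1
    · intro b _
      rw [if_neg]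
      intro h'
      apply h
      conv_lhs => rw [h']
      rw [h']
      rfl

end Transport

/-! ### The amplitudes of the isometry -/

section Amplitudes

variable {N d m k : ℕ} {S : Fin N → Finset (Fin N)}
  {V : Matrix (Fin N × (Fin m → Bool)) (Fin N) ℂ} {ν : Equiv.Perm (Fin N)}
  {φ : Fin N → ℕ → EuclideanSpace ℂ (Fin m → Bool)}

theorem cycleLength_pos (x : Fin N) : 0 < cycleLength ν x :=
  Function.minimalPeriod_pos_of_mem_periodicPts (ν.injective.mem_periodicPts x)

theorem mem_transitionSet
    (hS : ∀ x, S x = (Finset.range (cycleLength ν x)).image (fun i => (ν ^ i) x)) (x : Fin N) :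
    x ∈ S x := by
  rw [hS]
  exact Finset.mem_image.2 ⟨0, Finset.mem_range.2 (cycleLength_pos x), rfl⟩

theorem apply_eq_zero_of_notMem (hV : IsSparseIsometry d V ν φ)
    (hS : ∀ x, S x = (Finset.range (cycleLength ν x)).image (fun i => (ν ^ i) x)) {x y : Fin N}
    (hy : y ∉ S x) (a : Fin m → Bool) : V (y, a) x = 0 := by
  rw [hV.apply_eq]
  refine Finset.sum_eq_zero fun i hi => if_neg fun h => hy ?_
  rw [hS]
  exact Finset.mem_image.2 ⟨i, hi, h⟩

/-- The part of `V|x⟩` with system register `y` is a real multiple of a preparable state. -/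
theorem exists_amplitude (hV : IsSparseIsometry d V ν φ)
    (hφ : ∀ x, ∀ i < cycleLength ν x, φ x i ≠ 0 →
      Preparable ((‖φ x i‖ : ℂ)⁻¹ • φ x i) k) (x y : Fin N) :
    ∃ (r : ℝ) (P : List (Gate (Fin m))), P.length ≤ k ∧
      ∀ a, V (y, a) x = r * run P (ket zeroConf) a := by
  by_cases hy : ∃ i < cycleLength ν x, (ν ^ i) x = y
  · obtain ⟨i, hi, hiy⟩ := hy
    have hval : ∀ a, V (y, a) x = φ x i a := by
      intro a
      rw [hV.apply_eq, Finset.sum_eq_single i, if_pos hiy]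
      · intro j hj hji
        refine if_neg fun h => hji ?_
        refine Function.iterate_injOn_Iio_minimalPeriod (f := ν) (x := x)
          (Set.mem_Iio.2 (Finset.mem_range.1 hj)) (Set.mem_Iio.2 hi) ?_
        simp only [Equiv.Perm.iterate_eq_pow]
        rw [h, hiy]
      · intro h
        exact absurd (Finset.mem_range.2 hi) h
    by_cases h0 : φ x i = 0
    · exact ⟨0, [], by simp, fun a => by rw [hval, h0]; simp⟩
    · obtain ⟨P, hP, hPr⟩ := hφ x i hi h0
      refine ⟨‖φ x i‖, P, hP, fun a => ?_⟩
      have : run P (ket zeroConf) = WithLp.ofLp ((‖φ x i‖ : ℂ)⁻¹ • φ x i) := hPr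
      have hn : (‖φ x i‖ : ℂ) ≠ 0 := by simpa using h0
      rw [hval, this]
      simp only [PiLp.smul_apply, smul_eq_mul]
      rw [← mul_assoc, mul_inv_cancel₀ hn, one_mul]
  · refine ⟨0, [], by simp, fun a => ?_⟩
    rw [hV.apply_eq, Finset.sum_eq_zero]
    · simp
    · exact fun i hi => if_neg fun h => hy ⟨i, Finset.mem_range.1 hi, h⟩

theorem orthonormalOn_of_isometry (hV : V.conjTranspose * V = 1) {A : Finset (Fin N)}
    (hA : ∀ x ∈ A, ∀ y ∉ A, ∀ a, V (y, a) x = 0) {κ : Fin N → Fin N → ℝ}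
    {P : Fin N → Fin N → List (Gate (Fin m))}
    (hκ : ∀ x y a, V (y, a) x = κ x y * run (P x y) (ket zeroConf) a) : OrthonormalOn A κ P := by
  intro x hx x' hx'
  have h := congrFun (congrFun hV x) x'
  rw [Matrix.mul_apply, Matrix.one_apply] at h
  rw [← h, Fintype.sum_prod_type]
  rw [← Finset.sum_subset (Finset.subset_univ A)]
  · refine Finset.sum_congr rfl fun y _ => ?_
    rw [braket, dotProduct, Finset.mul_sum]
    refine Finset.sum_congr rfl fun a _ => ?_
    rw [Matrix.conjTranspose_apply, hκ, hκ]
    simp only [Pi.star_apply, star_mul', Complex.star_def, Complex.conj_ofReal]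
    ring
  · intro y _ hy
    refine Finset.sum_eq_zero fun a _ => ?_
    rw [hA x' hx' y hy, mul_zero]

end Amplitudes

/-! ### The algorithm -/

/-- On a space of dimension at most one, preservation of the trace leaves only the identity. -/
theorem superOp_eq_of_le_one {N : ℕ} (hN : N ≤ 1) {E : SuperOp N} (hE : IsQuantumOperation E)
    (ρ : Matrix (Fin N) (Fin N) ℂ) : E ρ = ρ := by
  have : Subsingleton (Fin N) := Fin.subsingleton_iff_le_one.2 hN
  ext x y
  have h := hE.tracePreserving ρ
  rw [Matrix.trace, Matrix.trace, Fintype.sum_subsingleton _ x, Fintype.sum_subsingleton _ x] at h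
  rw [Subsingleton.elim y x]
  exact h

theorem implements_nil_of_le_one {N : ℕ} (hN : N ≤ 1) {E : SuperOp N} (hE : IsQuantumOperation E)
    (S : Fin N → Finset (Fin N)) : Implements (w := 0) S [] E := by
  intro ρ
  rw [superOp_eq_of_le_one hN hE]
  let B : Matrix (Fin N × (Fin 0 → Bool)) (Fin N) ℂ := Matrix.of fun p x => if p.1 = x then 1 else 0
  have hI : inputIsometry N 0 = (outputIsometry (fun _ _ => false) :
      Matrix (Config N 0) (Fin N × (Fin 0 → Bool)) ℂ) * B := by
    ext p x
    rw [Matrix.mul_apply, Finset.sum_eq_single (x, fun _ => false)]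
    · simp [B, inputIsometry, outputIsometry]
    · rintro ⟨y, a⟩ _ hne
      have : y ≠ x := by
        rintro rfl
        exact hne (by rw [Subsingleton.elim a])
      simp [B, this]
    · simp
  rw [runMatrix, hI, Matrix.conjTranspose_one, Matrix.one_mul, Matrix.mul_one,
    Matrix.conjTranspose_mul]
  have hassoc : ∀ (a : Matrix (Config N 0) (Fin N × (Fin 0 → Bool)) ℂ)
      (b : Matrix (Fin N × (Fin 0 → Bool)) (Fin N) ℂ), a * b * ρ * (b.conjTranspose *
        a.conjTranspose) = a * (b * ρ * b.conjTranspose) * a.conjTranspose := by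
    intro a b
    simp only [Matrix.mul_assoc]
  rw [hassoc, traceWork_conj_outputIsometry (fun _ _ _ => Subsingleton.elim _ _)]
  congr 2
  ext x y
  simp [B, traceAncilla, Matrix.mul_apply]

/-- The rounding in `⌈log₂ N⌉` and the summand `1` are absorbed by `log N ≥ log 2`. -/
theorem clog_add_le {N : ℕ} (hN : 2 ≤ N) (k : ℕ) :
    ((Nat.clog 2 N + k + 1 : ℕ) : ℝ) ≤ 5 * Real.log N + k := by
  have hlog2 := Real.log_two_gt_d9
  have hlogN : Real.log 2 ≤ Real.log N := Real.log_le_log two_pos (by exact_mod_cast hN)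
  have h1 : (2 : ℝ) ^ (Nat.clog 2 N).pred ≤ N := by
    exact_mod_cast (Nat.pow_pred_clog_lt_self one_lt_two hN).le
  have h2 := Real.log_le_log (by positivity) h1
  rw [Real.log_pow] at h2
  have h3 : (Nat.clog 2 N : ℝ) ≤ ((Nat.clog 2 N).pred : ℝ) + 1 := by
    have : Nat.clog 2 N ≤ (Nat.clog 2 N).pred + 1 := by
      rw [Nat.pred_eq_sub_one]; omega
    exact_mod_cast this
  have h4 : (0 : ℝ) ≤ ((Nat.clog 2 N).pred : ℝ) := Nat.cast_nonneg _
  push_cast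
  nlinarith

/-- Query, apply the circuit for the cycle that was found, and query again. The circuit keeps the
system register inside the cycle, so the second query erases the answer register. -/
theorem exists_algorithm {N w M m : ℕ} {S : Fin N → Finset (Fin N)} (q₀ : Qubits N w)
    {V : Matrix (Fin N × (Fin m → Bool)) (Fin N) ℂ} {f : (Fin m → Bool) → Fin w → Bool}
    (hf : Injective f) (hS : ∀ x, ∀ y ∈ S x, S y = S x)
    (hV : ∀ x, ∀ y ∉ S x, ∀ a, V (y, a) x = 0)
    (G : Finset (Fin N) → List (Gate (Qubits N w))) (hG : ∀ A, (G A).length ≤ M)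
    (hrun : ∀ x s, run (G (S x)) (ket (Sum.elim (encode x) fun _ => false)) s =
      ∑ y, ∑ a, if s = Sum.elim (encode y) (f a) then V (y, a) x else 0)
    {E : SuperOp N} (hE : ∀ ρ, E ρ = traceAncilla (V * ρ * V.conjTranspose)) :
    ∃ alg : List (Step N w), Implements S alg E ∧ queryCount alg = 2 ∧ gateCount alg = M := by
  obtain ⟨steps, hq, hg, hr⟩ := exists_gate_steps S q₀ M G hG
  refine ⟨.query :: (steps ++ [.query]), ?_, by simp [queryCount, queryCount_append, hq],
    by simp [gateCount, gateCount_append, hg]⟩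
  have hmain : runMatrix S (Step.query :: (steps ++ [Step.query])) * inputIsometry N w =
      (outputIsometry f : Matrix (Config N w) _ ℂ) * V := by
    ext ⟨s, A⟩ x
    have hcol : (runMatrix S (Step.query :: (steps ++ [Step.query])) * inputIsometry N w :
        Matrix (Config N w) (Fin N) ℂ) (s, A) x =
        (runMatrix S (Step.query :: (steps ++ [Step.query])) *ᵥ fun p => inputIsometry N w p x) (s, A) :=
      rfl
    have hin : (fun t => ((Step.query : Step N w).toMatrix S *ᵥ
        fun p => inputIsometry N w p x) (t, symmDiff A (answer S s))) =
        if symmDiff A (answer S s) = S x then ket (Sum.elim (encode x) fun _ => false) else 0 := by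
      ext t
      rw [query_mulVec]
      simp only [inputIsometry, Matrix.of_apply, Prod.mk.injEq]
      by_cases ht : t = Sum.elim (encode x) fun _ => false
      · subst ht
        rw [answer_encode]
        by_cases h : symmDiff A (answer S s) = S x
        · rw [if_pos h, h]
          simp [ket_apply]
        · rw [if_neg h, if_neg]
          · rfl
          · rintro ⟨-, h'⟩
            exact h (symmDiff_eq_bot.1 h')
      · rw [if_neg (fun h => ht h.1)]
        split_ifs
        · rw [ket_apply, if_neg ht]
        · rfl
    rw [hcol, runMatrix, runMatrix_append, runMatrix, runMatrix, Matrix.one_mul,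
      ← Matrix.mulVec_mulVec, ← Matrix.mulVec_mulVec, query_mulVec, hr, hin, Matrix.mul_apply,
      Fintype.sum_prod_type]
    simp only [outputIsometry, Matrix.of_apply, Prod.mk.injEq, ite_mul, one_mul, zero_mul]
    by_cases hs : ∃ y ∈ S x, ∃ a, s = Sum.elim (encode y) (f a)
    · obtain ⟨y, hy, a, rfl⟩ := hs
      rw [answer_encode, hS x y hy]
      by_cases hA0 : A = ∅
      · subst hA0
        have : symmDiff (∅ : Finset (Fin N)) (S x) = S x := bot_symmDiff _
        rw [this, if_pos rfl, hrun]
        simp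
      · rw [if_neg]
        · simp [hA0, run]
        · intro h
          exact hA0 (symmDiff_eq_right.1 h)
    · have hzero : ∀ (p : Prop) [Decidable p], ∑ y, ∑ a,
          (if s = Sum.elim (encode y) (f a) ∧ p then V (y, a) x else 0) = 0 := by
        intro p _
        refine Finset.sum_eq_zero fun y _ => Finset.sum_eq_zero fun a _ => ?_
        split_ifs with h
        · exact hV x y (fun hy => hs ⟨y, hy, a, h.1⟩) a
        · rfl
      rw [hzero]
      -- A content of the system register outside the cycle does not occur after the gates.
      split_ifs with h
      · rw [h, hrun]
        simpa using hzero True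
      · simp [run]
  intro ρ
  have hassoc : ∀ R : Matrix (Config N w) (Config N w) ℂ,
      R * (inputIsometry N w * ρ * (inputIsometry N w).conjTranspose) * R.conjTranspose =
        R * inputIsometry N w * ρ * (R * inputIsometry N w).conjTranspose := by
    intro R
    rw [Matrix.conjTranspose_mul]
    simp only [Matrix.mul_assoc]
  rw [hassoc, hmain, Matrix.conjTranspose_mul, hE, ← traceWork_conj_outputIsometry hf]
  simp only [Matrix.mul_assoc]

end SparseStinespring

open SparseStinespring in
theorem mainTheorem1 (K : ℕ) :
    ∃ C : ℕ, ∀ (N d m c : ℕ)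
      (E : SparseStinespring.SuperOp N)
      (S : Fin N → Finset (Fin N))
      (V : Matrix (Fin N × (Fin m → Bool)) (Fin N) ℂ)
      (ν : Equiv.Perm (Fin N))
      (φ : Fin N → ℕ → EuclideanSpace ℂ (Fin m → Bool)),
      SparseStinespring.IsQuantumOperation E →
      SparseStinespring.IsInvariantlySparse d E S →
      SparseStinespring.IsSparseIsometry d V ν φ →
      (∀ ρ : Matrix (Fin N) (Fin N) ℂ, E ρ = SparseStinespring.traceAncilla (V * ρ * V.conjTranspose)) →
      (∀ x, S x =
        (Finset.range (SparseStinespring.cycleLength ν x)).image (fun i => (ν ^ i) x)) →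
      (∀ x, ∀ i < SparseStinespring.cycleLength ν x, φ x i ≠ 0 →
        SparseStinespring.Preparable ((‖φ x i‖ : ℂ)⁻¹ • φ x i) (K * c)) →
      ∃ (w : ℕ) (alg : List (SparseStinespring.Step N w)),
        SparseStinespring.Implements S alg E ∧
        SparseStinespring.queryCount alg ≤ C ∧
        (SparseStinespring.gateCount alg : ℝ) ≤ C * ((d : ℝ) ^ 2 * (Real.log N + c)) := by
  refine ⟨90 * (K + 5), fun N d m c E S V ν φ hE hsp hV hEV hS hφ => ?_⟩
  rcases le_or_gt N 1 with hN | hN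
  · -- Here `log N = 0`, so for `c = 0` no gate may be used.
    exact ⟨0, [], implements_nil_of_le_one hN hE S, Nat.zero_le _, by
      have : 0 ≤ Real.log N := Real.log_natCast_nonneg N
      simp only [SparseStinespring.gateCount, Nat.cast_zero]
      positivity⟩
  have hd : 1 ≤ d := (cycleLength_pos (⟨0, by omega⟩ : Fin N)).trans_le (hV.cycleLength_le _)
  have hSeq : ∀ x, ∀ y ∈ S x, S y = S x := by
    intro x y hy
    by_cases hxy : y = x
    · rw [hxy]
    · refine (hsp.disjoint_or_eq y x hxy).resolve_left fun h => ?_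
      exact Finset.disjoint_left.1 h (mem_transitionSet hS y) hy
  have hV0 : ∀ x, ∀ y ∉ S x, ∀ a, V (y, a) x = 0 := fun x y hy =>
    apply_eq_zero_of_notMem hV hS hy
  choose κ P hPl hκ using exists_amplitude hV hφ
  let n := Nat.clog 2 N
  let l := numColors d (K * c)
  let L := chainLength n d (K * c)
  let w := Fintype.card (Work N m l L)
  let e : Work N m l L ≃ Fin w := Fintype.equivFin _
  let M := 90 * (d * (d * (n + K * c + 1)))
  have hcirc : ∀ A : Finset (Fin N), ∃ gs : List (Gate (Qubits N w)), gs.length ≤ M ∧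
      ∀ x, S x = A → ∀ s, run gs (ket (Sum.elim (encode x) fun _ => false)) s =
        ∑ y, ∑ a, if s = Sum.elim (encode y) (ancEncoding e a) then V (y, a) x else 0 := by
    intro A
    by_cases hA : ∃ z, S z = A
    · obtain ⟨z, rfl⟩ := hA
      obtain ⟨gs, hl, hr⟩ := exists_cycle_circuit hd (encode_injective (N := N)) (hsp.card_le z)
        (orthonormalOn_of_isometry hV.isometry
          (fun x hx y hy => hV0 x y (by rwa [hSeq z x hx])) hκ)
        (fun x _ y _ => hPl x y)
      refine ⟨gs.map (Gate.map (numbering e) (numbering_injective e)), by simpa using hl,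
        fun x hx s => ?_⟩
      have hin : ket (Sum.elim (encode x) fun _ => false) = lift (numbering e)
          (Sum.elim (encode x) fun _ => false)
          (ket (conf l L (encode x) false (fun _ => false) fun _ => false)) := by
        have h0 : (fun _ => false : Fin w → Bool) = ancEncoding e fun _ => false := by
          ext j
          simp only [ancEncoding, conf, Sum.elim_inr]
          cases e.symm j <;> rfl
        rw [ket_eq_lift (f := numbering e), h0, sum_elim_comp_numbering]
      rw [hin, run_map_lift, hr x (hx ▸ mem_transitionSet hS x), lift_numbering]
      simp only [Finset.sum_apply, Pi.smul_apply, lift_conf_comp_numbering, smul_eq_mul,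
        Finset.mul_sum, mul_ite, mul_zero, ← hκ]
      refine Finset.sum_subset (Finset.subset_univ _) fun y _ hy => ?_
      refine Finset.sum_eq_zero fun a _ => ?_
      rw [hV0 x y (by rwa [hx]), ite_self]
    · -- The answer register never contains a set that is not of the form `S x` when gates are applied.
      exact ⟨[], by simp, fun x hx => (hA ⟨x, hx⟩).elim⟩
  choose G hGl hGr using hcirc
  obtain ⟨alg, himp, hq, hg⟩ := exists_algorithm (Sum.inr (e .flag)) (ancEncoding_injective e)
    hSeq hV0 G hGl (fun x s => hGr (S x) x rfl s) hEV
  refine ⟨w, alg, himp, by omega, ?_⟩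
  have hlog : 0 ≤ Real.log N := Real.log_natCast_nonneg N
  have hbound := clog_add_le hN (K * c)
  rw [hg]
  calc ((M : ℕ) : ℝ) = 90 * ((d : ℝ) ^ 2 * ((Nat.clog 2 N + K * c + 1 : ℕ) : ℝ)) := by
        simp only [M, n]; push_cast; ring
    _ ≤ 90 * ((d : ℝ) ^ 2 * ((K + 5) * (Real.log N + c))) := by
        gcongr
        refine hbound.trans ?_
        push_cast
        have : (0 : ℝ) ≤ K * Real.log N := by positivity
        nlinarith [(Nat.cast_nonneg c : (0 : ℝ) ≤ c)]
    _ = ((90 * (K + 5) : ℕ) : ℝ) * ((d : ℝ) ^ 2 * (Real.log N + c)) := by push_cast; ring
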